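/- Let $(\Omega,\mathcal F,\mathbb P)$ be a complete probability space, $H,\Xi$ real separable Hilbert spaces, $W$ a cylindrical Wiener process in $\Xi$, and $(\mathcal F_t)$ the filtration generated by $W$ and augmented with the $\mathbb P$-null sets. For real $p\ge 1$, let $\mathcal S^p(H)$ be the space of predictable processes $Y$ on $[0,T]$ with $\mathbb E\sup_{\tau\in[0,T]}|Y_\tau|^p<\infty$. Assume: (i) $A$ generates a strongly continuous semigroup $(e^{sA})_{s\ge0}$ on $H$; (ii) $F:[0,T]\times H\to H$ is measurable, $|F(t,x)|\le C_0(1+|x|)$, $|F(t,x)-F(t,y)|\le C_0|x-y|$, and each $F(t,\cdot)$ is continuous and Gâteaux differentiable with strongly continuous gradient; (iii) $G:[0,T]\to L(\Xi,H)$ is such that $t\mapsto G(t)\xi$ is measurable for every $\xi\in\Xi$, $G$ is bounded in operator norm, and for some $0\le\gamma<1/2$ the Hilbert–Schmidt norms satisfy $|e^{sA}G(t)|_{L_2(\Xi,H)}\le C_0s^{-\gamma}$ for all $s>0$, $t\in[0,T]$; (iv) every $G(t)$ has a bounded inverse and $|G^{-1}(t)|\le B$ for all $t\in[0,T]$. For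 $0\le t<T$ and $x\in H$ let $X^{t,x}\in\mathcal S^p(H)$ (for some $p\ge1$) be the mild solution of $$dX_\tau=AX_\tau\,d\tau+F(\tau,X_\tau)\,d\tau+G(\tau)\,dW_\tau,\quad \tau\in[t,T],\qquad X_\tau=x\ \text{ for }\tau\le t,$$ let $\nabla_xX^{t,x}h$ be the derivative at $x$ in the direction $h\in H$ of the map $y\mapsto X^{t,y}\in\mathcal S^p(H)$, and let, for $t<s\le T$, $$U^{h,t,x}_s:=\frac1{s-t}\int_t^s\langle G^{-1}(r)\nabla_xX^{t,x}_r h,\,dW_r\rangle$$ (with the continuous version of the Itô integral). Then for every real $q\ge1$ there is a constant $C>0$, not depending on $t,s,x,h$, such that for all $0\le t<s\le T$ and all $x,h\in H$ $$\big(\mathbb E|U^{h,t,x}_s|^q\big)^{1/q}\le C\,(s-t)^{-1/2}|h|,$$ and for all $0\le t<T$ and all $x,h\in H$ $$\Big(\mathbb E\sup_{s\in[\frac{t+T}2,T]}|U^{h,t,x}_s|^q\Big)^{1/q}\le C\,(T-t)^{-1/2}|h|.$$ -/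

import Mathlib

open MeasureTheory ProbabilityTheory Filter Topology
open scoped NNReal ENNReal

/-! ### Semigroups, Gateaux differentiability, Hilbert-Schmidt norm -/

/-- `S` is a strongly continuous semigroup of bounded operators on `H`. -/
structure IsC0Semigroup {H : Type*} [NormedAddCommGroup H] [NormedSpace ℝ H]
    (S : ℝ≥0 → H →L[ℝ] H) : Prop where
  zero : S 0 = ContinuousLinearMap.id ℝ H
  add : ∀ s t, S (s + t) = (S s).comp (S t)
  strongly_continuous : ∀ x, Continuous fun t => S t x

/-- The (in general unbounded) operator `A` is the infinitesimal generator of `S`: `x` is in the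
domain of `A` with `A x = y` iff `(S s x - x) / s → y` as `s ↓ 0`. -/
def IsSemigroupGenerator {H : Type*} [NormedAddCommGroup H] [NormedSpace ℝ H]
    (A : H →ₗ.[ℝ] H) (S : ℝ≥0 → H →L[ℝ] H) : Prop :=
  ∀ x y : H, (x, y) ∈ A.graph ↔
    Tendsto (fun s : ℝ≥0 => (s : ℝ)⁻¹ • (S s x - x)) (𝓝[>] 0) (𝓝 y)

/-- The class `𝒢¹(E, V)`: continuous, Gateaux differentiable maps with strongly continuous
gradient. -/
def IsGateauxC1 {E V : Type*} [NormedAddCommGroup E] [NormedSpace ℝ E]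
    [NormedAddCommGroup V] [NormedSpace ℝ V] (f : E → V) : Prop :=
  Continuous f ∧ ∃ f' : E → E →L[ℝ] V,
    (∀ x e, HasLineDerivAt ℝ f (f' x e) x e) ∧ ∀ e, Continuous fun x => f' x e

/-- The squared Hilbert-Schmidt norm of a bounded operator (`∞` if it is not Hilbert-Schmidt):
the supremum of `∑ ‖L e‖²` over all finite orthonormal families. -/
noncomputable def hsNormSq {Ξ K : Type*} [NormedAddCommGroup Ξ] [InnerProductSpace ℝ Ξ]
    [NormedAddCommGroup K] [InnerProductSpace ℝ K] (L : Ξ →L[ℝ] K) : ℝ≥0∞ :=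
  ⨆ (s : Finset Ξ) (_ : Orthonormal ℝ (fun e : s => (e : Ξ))), ∑ e ∈ s, ‖L e‖ₑ ^ 2

/-! ### Cylindrical Wiener process and its filtration -/

/-- Lebesgue measure on the half line `[0, ∞)`. -/
noncomputable def lebesgueHalfLine : Measure ℝ≥0 :=
  (volume : Measure ℝ).comap ((↑) : ℝ≥0 → ℝ)

/-- A cylindrical Wiener process with values in `Ξ`; `W t ξ` is the real random variable
`⟨ξ, W_t⟩`. It is a centred Gaussian family with covariance
`E[⟨ξ, W_s⟩ ⟨η, W_t⟩] = min(s, t) ⟨ξ, η⟩` and each `⟨ξ, W⟩` has a.s. continuous paths. (Almost sure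
linearity in `ξ` follows from the covariance.) -/
structure IsCylindricalWiener {Ω Ξ : Type*} {mΩ : MeasurableSpace Ω}
    [NormedAddCommGroup Ξ] [InnerProductSpace ℝ Ξ]
    (W : ℝ≥0 → Ξ → Ω → ℝ) (P : Measure Ω) : Prop where
  measurable : ∀ t ξ, Measurable (W t ξ)
  gaussian : IsGaussianProcess (fun p : ℝ≥0 × Ξ => W p.1 p.2) P
  mean : ∀ t ξ, ∫ ω, W t ξ ω ∂P = 0
  covariance : ∀ s t ξ η, ∫ ω, W s ξ ω * W t η ω ∂P = (min s t : ℝ≥0) * inner ℝ ξ η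
  continuous : ∀ ξ, ∀ᵐ ω ∂P, Continuous fun t => W t ξ ω

/-- The filtration `ℱ_t` generated by `W_s`, `s ≤ t`, augmented with the null sets. -/
def wienerFiltration {Ω Ξ : Type*} {mΩ : MeasurableSpace Ω}
    [NormedAddCommGroup Ξ] [InnerProductSpace ℝ Ξ]
    {W : ℝ≥0 → Ξ → Ω → ℝ} {P : Measure Ω} [P.IsComplete] (hW : IsCylindricalWiener W P) :
    Filtration ℝ≥0 mΩ where
  seq t := (⨆ (s : ℝ≥0) (_ : s ≤ t) (ξ : Ξ), MeasurableSpace.comap (W s ξ) (borel ℝ)) ⊔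
    MeasurableSpace.generateFrom {N | P N = 0}
  mono' _ _ hst := sup_le_sup
    (iSup_le fun r => iSup_le fun hr => le_iSup_of_le r (le_iSup_of_le (hr.trans hst) le_rfl))
    le_rfl
  le' t := sup_le
    (iSup_le fun s => iSup_le fun _ => iSup_le fun ξ => by
      rw [← BorelSpace.measurable_eq (α := ℝ)]
      exact (hW.measurable s ξ).comap_le)
    (MeasurableSpace.generateFrom_le fun N hN => Measure.IsComplete.out' N hN)

/-! ### The Ito integral with respect to a cylindrical Wiener process -/

/-- A simple predictable operator valued integrand
`∑ᵢ 1_{(aᵢ, bᵢ]} cᵢ (⟨eᵢ, ·⟩ kᵢ)` with `cᵢ` bounded and `ℱ_{aᵢ}`-measurable. -/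
structure SimpleIntegrand {Ω : Type*} {mΩ : MeasurableSpace Ω} (𝓕 : Filtration ℝ≥0 mΩ)
    (Ξ K : Type*) where
  n : ℕ
  a : Fin n → ℝ≥0
  b : Fin n → ℝ≥0
  le : ∀ i, a i ≤ b i
  c : Fin n → Ω → ℝ
  measurable : ∀ i, Measurable[𝓕 (a i)] (c i)
  bounded : ∀ i, ∃ M, ∀ ω, |c i ω| ≤ M
  e : Fin n → Ξ
  k : Fin n → K

/-- The value of a simple integrand at time `σ`. -/
noncomputable def SimpleIntegrand.val {Ω Ξ K : Type*} {mΩ : MeasurableSpace Ω}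
    {𝓕 : Filtration ℝ≥0 mΩ} [NormedAddCommGroup Ξ] [InnerProductSpace ℝ Ξ]
    [NormedAddCommGroup K] [InnerProductSpace ℝ K]
    (Ψ : SimpleIntegrand 𝓕 Ξ K) (σ : ℝ≥0) (ω : Ω) : Ξ →L[ℝ] K :=
  ∑ i, (Set.Ioc (Ψ.a i) (Ψ.b i)).indicator
    (fun _ => Ψ.c i ω • (innerSL ℝ (Ψ.e i)).smulRight (Ψ.k i)) σ

/-- The stochastic integral `∫₀^∞ Ψ dW` of a simple integrand. -/
noncomputable def SimpleIntegrand.integral {Ω Ξ K : Type*} {mΩ : MeasurableSpace Ω}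
    {𝓕 : Filtration ℝ≥0 mΩ} [NormedAddCommGroup K] [InnerProductSpace ℝ K]
    (Ψ : SimpleIntegrand 𝓕 Ξ K) (W : ℝ≥0 → Ξ → Ω → ℝ) (ω : Ω) : K :=
  ∑ i, (Ψ.c i ω * (W (Ψ.b i) (Ψ.e i) ω - W (Ψ.a i) (Ψ.e i) ω)) • Ψ.k i

/-- `I` is (a version of) the Ito integral `∫_u^v Φ_σ dW_σ` of the predictable operator valued
process `Φ`: the mean square limit of the integrals of simple integrands which converge to
`1_{(u, v]} Φ` in `L²(Ω × [0, ∞); L₂(Ξ, K))`. -/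
def IsItoIntegral {Ω Ξ K : Type*} {mΩ : MeasurableSpace Ω}
    [NormedAddCommGroup Ξ] [InnerProductSpace ℝ Ξ]
    [NormedAddCommGroup K] [InnerProductSpace ℝ K]
    (W : ℝ≥0 → Ξ → Ω → ℝ) (𝓕 : Filtration ℝ≥0 mΩ) (P : Measure Ω) (u v : ℝ≥0)
    (Φ : ℝ≥0 → Ω → Ξ →L[ℝ] K) (I : Ω → K) : Prop :=
  (∀ ξ, IsStronglyPredictable 𝓕
    fun σ ω => (Set.Ioc u v).indicator (fun r => Φ r ω ξ) σ) ∧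
  AEStronglyMeasurable I P ∧
  ∃ Ψ : ℕ → SimpleIntegrand 𝓕 Ξ K,
    Tendsto (fun n => ∫⁻ ω, ∫⁻ σ,
      hsNormSq ((Set.Ioc u v).indicator (fun r => Φ r ω) σ - (Ψ n).val σ ω)
        ∂lebesgueHalfLine ∂P) atTop (𝓝 0) ∧
    Tendsto (fun n => ∫⁻ ω, ‖I ω - (Ψ n).integral W ω‖ₑ ^ 2 ∂P) atTop (𝓝 0)

/-! ### The forward equation and the Bismut weight -/

/-- The space `𝒮ᵖ(K)`: predictable processes on `[0, T]` with `E sup_{τ ≤ T} |Y_τ|ᵖ < ∞`. -/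
def MemSp {Ω K : Type*} {mΩ : MeasurableSpace Ω} [NormedAddCommGroup K]
    (𝓕 : Filtration ℝ≥0 mΩ) (P : Measure Ω) (T : ℝ≥0) (p : ℝ) (Y : ℝ≥0 → Ω → K) : Prop :=
  IsStronglyPredictable 𝓕 (fun τ ω => (Set.Iic T).indicator (fun r => Y r ω) τ) ∧
  ∫⁻ ω, ⨆ τ ∈ Set.Iic T, ‖Y τ ω‖ₑ ^ p ∂P < ∞

/-- `X` is a mild solution in `𝒮ᵖ(H)` of
`dX_τ = A X_τ dτ + F(τ, X_τ) dτ + G(τ) dW_τ`, `τ ∈ [t, T]`, `X_t = x`, where `S s = e^{sA}`,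
extended by `X_τ = x` for `τ ≤ t`. -/
structure IsMildSolution {Ω H Ξ : Type*} {mΩ : MeasurableSpace Ω}
    [NormedAddCommGroup Ξ] [InnerProductSpace ℝ Ξ]
    [NormedAddCommGroup H] [InnerProductSpace ℝ H]
    (W : ℝ≥0 → Ξ → Ω → ℝ) (𝓕 : Filtration ℝ≥0 mΩ) (P : Measure Ω)
    (S : ℝ≥0 → H →L[ℝ] H) (F : ℝ≥0 → H → H) (G : ℝ≥0 → Ξ →L[ℝ] H)
    (T : ℝ≥0) (p : ℝ) (t : ℝ≥0) (x : H) (X : ℝ≥0 → Ω → H) : Prop where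
  memSp : MemSp 𝓕 P T p X
  initial : ∀ τ ≤ t, ∀ᵐ ω ∂P, X τ ω = x
  equation : ∀ τ, t ≤ τ → τ ≤ T → ∃ I : Ω → H,
    IsItoIntegral W 𝓕 P t τ (fun σ _ => (S (τ - σ)).comp (G σ)) I ∧
    ∀ᵐ ω ∂P,
      IntegrableOn (fun σ => S (τ - σ) (F σ (X σ ω))) (Set.Ioc t τ) lebesgueHalfLine ∧
      X τ ω = S (τ - t) x
        + ∫ σ in Set.Ioc t τ, S (τ - σ) (F σ (X σ ω)) ∂lebesgueHalfLine + I ω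

/-- `V = ∇ₓX h`: for a family `X` of processes indexed by the initial datum, `V` is the directional
derivative at `x` along `h` of the map `y ↦ X y` with values in `𝒮ᵖ(H)`. -/
def IsDirectionalDerivSp {Ω H : Type*} {mΩ : MeasurableSpace Ω}
    [NormedAddCommGroup H] [InnerProductSpace ℝ H]
    (𝓕 : Filtration ℝ≥0 mΩ) (P : Measure Ω) (T : ℝ≥0) (p : ℝ)
    (X : H → ℝ≥0 → Ω → H) (x h : H) (V : ℝ≥0 → Ω → H) : Prop :=
  MemSp 𝓕 P T p V ∧
  Tendsto (fun ε : ℝ => ∫⁻ ω, ⨆ τ ∈ Set.Iic T,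
    ‖ε⁻¹ • (X (x + ε • h) τ ω - X x τ ω) - V τ ω‖ₑ ^ p ∂P) (𝓝[≠] 0) (𝓝 0)

/-- `U` is the Bismut weight `U_s = (s - t)⁻¹ ∫_t^s ⟨G(r)⁻¹ V_r, dW_r⟩`, `s ∈ (t, T]`, where
`V = ∇ₓX h`; as usual the stochastic integral is taken in its a.s. continuous version. -/
structure IsBismutWeight {Ω H Ξ : Type*} {mΩ : MeasurableSpace Ω}
    [NormedAddCommGroup Ξ] [InnerProductSpace ℝ Ξ]
    [NormedAddCommGroup H] [InnerProductSpace ℝ H]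
    (W : ℝ≥0 → Ξ → Ω → ℝ) (𝓕 : Filtration ℝ≥0 mΩ) (P : Measure Ω)
    (G : ℝ≥0 → Ξ →L[ℝ] H) (T t : ℝ≥0) (V : ℝ≥0 → Ω → H) (U : ℝ≥0 → Ω → ℝ) : Prop where
  eq_integral : ∀ s, t < s → s ≤ T → ∃ M : Ω → ℝ,
    IsItoIntegral W 𝓕 P t s (fun r ω => innerSL ℝ ((G r).inverse (V r ω))) M ∧
    ∀ᵐ ω ∂P, U s ω = ((s : ℝ) - t)⁻¹ * M ω
  continuous : ∀ᵐ ω ∂P, ContinuousOn (fun s => U s ω) (Set.Ioc t T)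

/-! ### Hypotheses on the coefficients -/

/-- Hypotheses on `A`, `F`, `G` ensuring existence of the forward process: `A` generates the
`C₀`-semigroup `S`, `F` is measurable, of linear growth and Lipschitz in `x`, `G` is strongly
measurable and `|e^{sA} G(t)|_{L₂(Ξ,H)} ≤ C s^{-γ}` with `0 ≤ γ < 1/2`. -/
structure ForwardHypothesis {H Ξ : Type*}
    [NormedAddCommGroup H] [InnerProductSpace ℝ H] [MeasurableSpace H]
    [NormedAddCommGroup Ξ] [InnerProductSpace ℝ Ξ]
    (T : ℝ≥0) (A : H →ₗ.[ℝ] H) (S : ℝ≥0 → H →L[ℝ] H) (F : ℝ≥0 → H → H)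
    (G : ℝ≥0 → Ξ →L[ℝ] H) : Prop where
  semigroup : IsC0Semigroup S
  generator : IsSemigroupGenerator A S
  measurable_F : Measurable fun q : Set.Iic T × H => F q.1 q.2
  bound_F : ∃ C : ℝ, 0 < C ∧ ∀ t ≤ T, ∀ x y : H,
    ‖F t x‖ ≤ C * (1 + ‖x‖) ∧ ‖F t x - F t y‖ ≤ C * ‖x - y‖
  measurable_G : ∀ ξ : Ξ, Measurable fun t : Set.Iic T => G t ξ
  bound_G : ∃ C γ : ℝ, 0 < C ∧ 0 ≤ γ ∧ γ < 1 / 2 ∧ ∀ s : ℝ≥0, 0 < s → ∀ t ≤ T,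
    hsNormSq ((S s).comp (G t)) ≤ ENNReal.ofReal (C * (s : ℝ) ^ (-γ)) ^ 2

/-- Additional hypotheses: `F(t, ·) ∈ 𝒢¹(H, H)` and `|G(t)| ≤ C` for `t ∈ [0, T]`. -/
structure ForwardRegularity {H Ξ : Type*}
    [NormedAddCommGroup H] [InnerProductSpace ℝ H]
    [NormedAddCommGroup Ξ] [InnerProductSpace ℝ Ξ]
    (T : ℝ≥0) (F : ℝ≥0 → H → H) (G : ℝ≥0 → Ξ →L[ℝ] H) : Prop where
  gateaux_F : ∀ t ≤ T, IsGateauxC1 (F t)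
  bounded_G : ∃ C : ℝ, 0 < C ∧ ∀ t ≤ T, ‖G t‖ ≤ C

/-- Each `G(t)`, `t ∈ [0, T]`, has a bounded inverse, with `|G(t)⁻¹| ≤ B`. -/
def UniformlyInvertible {H Ξ : Type*}
    [NormedAddCommGroup H] [InnerProductSpace ℝ H]
    [NormedAddCommGroup Ξ] [InnerProductSpace ℝ Ξ]
    (T : ℝ≥0) (G : ℝ≥0 → Ξ →L[ℝ] H) : Prop :=
  ∃ B : ℝ, ∀ t ≤ T, (G t).IsInvertible ∧ ‖(G t).inverse‖ ≤ B

/-! The noise is additive, so two mild solutions with different initial data carry the same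
stochastic convolution, and their difference solves a pathwise integral inequality. Gronwall gives
`|X^y_τ - X^x_τ| ≤ K |y - x|` almost surely with a deterministic `K`
(`exists_forall_isMildSolution_enorm_sub_le`). Passing to difference quotients, `|∇ₓX h| ≤ K |h|`
almost surely at each time from `t` to `T` (`IsDirectionalDerivSp.ae_enorm_le`). The integrand `G⁻¹
∇ₓX h` is therefore bounded by a multiple of `|h|`, and the quadratic variation of its Itô integral
over `(t, v]` is at most a constant times `|h|² (v - t)`.

An Itô integral with quadratic variation bounded by `β` has a maximal function with Gaussian tails
at scale `√β`. For simple integrands this is the exponential martingale `exp(r ∫Ψ dW - r²/2 ∫|Ψ|²)`,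
a maximal inequality and an optimal choice of `r`
(`SimpleIntegrand.measure_exists_le_abs_integral_truncate`). The same inequality shows that small
energy forces the integral to be small in probability; this replaces the Itô isometry, makes the
integral unique (`IsItoIntegral.ae_eq`) and carries the tail bound to general integrands
(`IsItoIntegral.measure_lt_iSup_enorm`).

Gaussian tails at scale `ρ` bound every `q`-th moment norm by a multiple of `ρ`
(`exists_forall_lintegral_rpow_le_of_gaussian_tail`). With `ρ` of order `|h| √(v - t)`, division by
a time of order `v - t` leaves `(v - t)^(-1/2) |h|`. The supremum over an interval reduces to a
dense sequence by path continuity. -/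

/-! ### Gaussian increments of the cylindrical Wiener process -/

namespace IsCylindricalWiener

variable {Ω Ξ : Type*} {mΩ : MeasurableSpace Ω} {P : Measure Ω}
  [NormedAddCommGroup Ξ] [InnerProductSpace ℝ Ξ] {W : ℝ≥0 → Ξ → Ω → ℝ}

lemma memLp_two (hW : IsCylindricalWiener W P) (t : ℝ≥0) (ξ : Ξ) : MemLp (W t ξ) 2 P :=
  (hW.gaussian.hasGaussianLaw_eval (t, ξ)).memLp_two

/-- The past of a cylindrical Wiener process together with its increments over `[s, s']` is a
Gaussian family. -/
lemma isGaussianProcess_past_increment (hW : IsCylindricalWiener W P) (s s' : ℝ≥0) :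
    IsGaussianProcess (Sum.elim (fun (p : Set.Iic s × Ξ) => W p.1 p.2)
      (fun ξ ω => W s' ξ ω - W s ξ ω)) P := by
  classical
  refine hW.gaussian.of_isGaussianProcess ?_
  rintro (p | ξ)
  · exact ⟨{((p.1 : ℝ≥0), p.2)}, ContinuousLinearMap.proj ⟨_, Finset.mem_singleton_self _⟩,
      fun ω => rfl⟩
  · refine ⟨{(s', ξ), (s, ξ)}, ContinuousLinearMap.proj ⟨(s', ξ), by simp⟩
      - ContinuousLinearMap.proj ⟨(s, ξ), by simp⟩, fun ω => rfl⟩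

variable [IsProbabilityMeasure P]

lemma covariance_eq (hW : IsCylindricalWiener W P) (s t : ℝ≥0) (ξ η : Ξ) :
    cov[W s ξ, W t η; P] = (min s t : ℝ≥0) * inner ℝ ξ η := by
  rw [covariance_eq_sub (hW.memLp_two s ξ) (hW.memLp_two t η), hW.mean, hW.mean, ← hW.covariance]
  simp

lemma covariance_increment (hW : IsCylindricalWiener W P) {s s' : ℝ≥0} (h : s ≤ s') (ξ η : Ξ) :
    cov[fun ω => W s' ξ ω - W s ξ ω, fun ω => W s' η ω - W s η ω; P]
      = ((s' : ℝ) - s) * inner ℝ ξ η := by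
  rw [covariance_fun_sub_fun_sub (hW.memLp_two _ _) (hW.memLp_two _ _) (hW.memLp_two _ _)
    (hW.memLp_two _ _)]
  simp only [hW.covariance_eq, min_self, min_eq_left h, min_eq_right h]
  ring

/-- Both minima `min u s'` and `min u s` equal `u`. In a jointly Gaussian family this vanishing
covariance is independence. -/
lemma covariance_past_increment (hW : IsCylindricalWiener W P) {u s s' : ℝ≥0} (hu : u ≤ s)
    (h : s ≤ s') (ξ η : Ξ) :
    cov[W u ξ, fun ω => W s' η ω - W s η ω; P] = 0 := by
  rw [covariance_fun_sub_right (hW.memLp_two _ _) (hW.memLp_two _ _) (hW.memLp_two _ _)]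
  simp only [hW.covariance_eq, min_eq_left hu, min_eq_left (hu.trans h), sub_self]

/-- The increments after time `s` are independent of the (augmented) past up to time `s`. -/
lemma indep_filtration_increment [P.IsComplete] (hW : IsCylindricalWiener W P) {s s' : ℝ≥0}
    (h : s ≤ s') :
    Indep (wienerFiltration hW s)
      (MeasurableSpace.comap (fun ω ξ => W s' ξ ω - W s ξ ω) inferInstance) P := by
  have hind : IndepFun (fun ω (p : Set.Iic s × Ξ) => W p.1 p.2 ω)
      (fun ω ξ => W s' ξ ω - W s ξ ω) P :=
    (hW.isGaussianProcess_past_increment s s').indepFun_of_covariance_eq_zero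
      (fun p => (hW.measurable _ _).aemeasurable)
      (fun ξ => ((hW.measurable _ _).sub (hW.measurable _ _)).aemeasurable)
      (fun p ξ => hW.covariance_past_increment p.1.2 h _ _)
  rw [IndepFun_iff_Indep] at hind
  -- Augmentation is harmless: every event of the augmented past agrees almost everywhere with one
  -- of the raw past, and independence sees only measures.
  have hle : wienerFiltration hW s ≤ eventuallyMeasurableSpace
      (MeasurableSpace.comap (fun ω (p : Set.Iic s × Ξ) => W p.1 p.2 ω) inferInstance) (ae P) := by
    refine sup_le ?_ (MeasurableSpace.generateFrom_le fun N hN => ?_)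
    · refine le_trans ?_ le_eventuallyMeasurableSpace
      refine iSup_le fun r => iSup_le fun hr => iSup_le fun ξ => ?_
      rw [← BorelSpace.measurable_eq (α := ℝ)]
      rintro _ ⟨B, hB, rfl⟩
      exact ⟨(fun f => f (⟨r, hr⟩, ξ)) ⁻¹' B, measurable_pi_apply _ hB, rfl⟩
    · exact ⟨∅, @MeasurableSet.empty _ (_), ae_eq_empty.2 hN⟩
  refine indep_of_indep_of_le_left ?_ hle
  rw [Indep_iff] at hind ⊢
  rintro A B ⟨A', hA', hAA'⟩ hB
  rw [measure_congr hAA', ← hind A' B hA' hB]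
  exact measure_congr (hAA'.inter (ae_eq_refl B))

/-- The Laplace transform of the increments of a cylindrical Wiener process. -/
lemma lintegral_exp_increment (hW : IsCylindricalWiener W P) {s s' : ℝ≥0} (h : s ≤ s') {n : ℕ}
    (e : Fin n → Ξ) (x : Fin n → ℝ) :
    ∫⁻ ω, ENNReal.ofReal (Real.exp (∑ i, x i * (W s' (e i) ω - W s (e i) ω))) ∂P
      = ENNReal.ofReal (Real.exp (((s' : ℝ) - s) * ‖∑ i, x i • e i‖ ^ 2 / 2)) := by
  have hG : IsGaussianProcess (fun (i : Fin n) ω => W s' (e i) ω - W s (e i) ω) P :=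
    (hW.isGaussianProcess_past_increment s s').comp_right (fun i => Sum.inr (e i))
  have hY : HasGaussianLaw (fun ω => ∑ i, x i * (W s' (e i) ω - W s (e i) ω)) P :=
    (hG.smul x).hasGaussianLaw_fun_sum (I := Finset.univ)
  have hL : ∀ i, MemLp (fun ω => x i * (W s' (e i) ω - W s (e i) ω)) 2 P := fun i =>
    ((hW.memLp_two _ _).sub (hW.memLp_two _ _)).const_mul _
  have hmean : ∫ ω, ∑ i, x i * (W s' (e i) ω - W s (e i) ω) ∂P = 0 := by
    rw [integral_finsetSum _ fun i _ => (hL i).integrable one_le_two]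
    refine Finset.sum_eq_zero fun i _ => ?_
    rw [integral_const_mul, integral_sub ((hW.memLp_two _ _).integrable one_le_two)
      ((hW.memLp_two _ _).integrable one_le_two), hW.mean, hW.mean]
    simp
  have hvar : Var[fun ω => ∑ i, x i * (W s' (e i) ω - W s (e i) ω); P]
      = ((s' : ℝ) - s) * ‖∑ i, x i • e i‖ ^ 2 := by
    rw [← covariance_self hY.aemeasurable, covariance_fun_sum_fun_sum hL hL,
      ← real_inner_self_eq_norm_sq, sum_inner, Finset.mul_sum]
    refine Finset.sum_congr rfl fun i _ => ?_
    rw [inner_sum, Finset.mul_sum]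
    refine Finset.sum_congr rfl fun j _ => ?_
    rw [covariance_const_mul_left, covariance_const_mul_right, hW.covariance_increment h,
      inner_smul_left, inner_smul_right]
    simp only [conj_trivial]
    ring
  have hmap := hY.map_eq_gaussianReal
  rw [hmean, hvar] at hmap
  have hpos : 0 ≤ ((s' : ℝ) - s) * ‖∑ i, x i • e i‖ ^ 2 :=
    mul_nonneg (sub_nonneg.2 (by exact_mod_cast h)) (sq_nonneg _)
  have hint : Integrable
      (fun ω => Real.exp (∑ i, x i * (W s' (e i) ω - W s (e i) ω))) P := by
    have := integrable_exp_mul_gaussianReal (μ := 0)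
      (v := (((s' : ℝ) - s) * ‖∑ i, x i • e i‖ ^ 2).toNNReal) 1
    rw [← hmap, integrable_map_measure (by fun_prop) hY.aemeasurable] at this
    simpa [Function.comp_def] using this
  rw [← ofReal_integral_eq_lintegral_ofReal hint (ae_of_all _ fun ω => (Real.exp_pos _).le)]
  congr 1
  have := mgf_gaussianReal hmap 1
  simpa [mgf, Real.coe_toNNReal _ hpos] using this

/-- One step of the exponential supermartingale: conditioning on the past, an exponential of a
stochastic increment compensated by half its quadratic variation integrates to one. -/
lemma lintegral_mul_exp_increment [P.IsComplete] (hW : IsCylindricalWiener W P) {s s' : ℝ≥0}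
    (h : s ≤ s') {n : ℕ} (e : Fin n → Ξ) {c : Fin n → Ω → ℝ}
    (hc : ∀ i, Measurable[wienerFiltration hW s] (c i)) {Y : Ω → ℝ≥0∞}
    (hY : Measurable[wienerFiltration hW s] Y) :
    ∫⁻ ω, Y ω * ENNReal.ofReal (Real.exp (∑ i, c i ω * (W s' (e i) ω - W s (e i) ω)
      - ((s' : ℝ) - s) * ‖∑ i, c i ω • e i‖ ^ 2 / 2)) ∂P = ∫⁻ ω, Y ω ∂P := by
  have hm := (wienerFiltration hW).le s
  -- `Z` collects everything known at time `s`, `D` the increments. By independence their joint law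
  -- is a product, so the coefficients can be frozen while `D` is integrated out, and the Laplace
  -- transform cancels the compensator.
  let D : Ω → Fin n → ℝ := fun ω i => W s' (e i) ω - W s (e i) ω
  let Z : Ω → ℝ≥0∞ × (Fin n → ℝ) := fun ω => (Y ω, fun i => c i ω)
  have hD : Measurable D := measurable_pi_lambda _ fun i =>
    (hW.measurable _ _).sub (hW.measurable _ _)
  have hZ' : Measurable[wienerFiltration hW s] Z := by
    have hc' : Measurable[wienerFiltration hW s] fun ω i => c i ω :=
      @measurable_pi_lambda _ _ _ (wienerFiltration hW s) _ (fun ω i => c i ω) hc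
    exact hY.prodMk hc'
  have hZ : Measurable Z := hZ'.mono hm le_rfl
  have hind : IndepFun Z D P := by
    rw [IndepFun_iff_Indep]
    refine indep_of_indep_of_le (hW.indep_filtration_increment h) hZ'.comap_le ?_
    have : D = (fun f i => f (e i)) ∘ (fun ω ξ => W s' ξ ω - W s ξ ω) := rfl
    rw [this, ← MeasurableSpace.comap_comp]
    refine MeasurableSpace.comap_mono (Measurable.comap_le ?_)
    exact measurable_pi_lambda _ fun i => measurable_pi_apply _
  have hprod := (indepFun_iff_map_prod_eq_prod_map_map hZ.aemeasurable hD.aemeasurable).1 hind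
  let g : (ℝ≥0∞ × (Fin n → ℝ)) × (Fin n → ℝ) → ℝ≥0∞ := fun z =>
    z.1.1 * ENNReal.ofReal (Real.exp (∑ i, z.1.2 i * z.2 i
      - ((s' : ℝ) - s) * ‖∑ i, z.1.2 i • e i‖ ^ 2 / 2))
  have hcont : Continuous fun y : Fin n → ℝ => ‖∑ i, y i • e i‖ := by fun_prop
  have hg : Measurable g := by
    have := hcont.measurable
    fun_prop
  have hpr : IsProbabilityMeasure (P.map D) := Measure.isProbabilityMeasure_map hD.aemeasurable
  calc _ = ∫⁻ ω, g (Z ω, D ω) ∂P := rfl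
    _ = ∫⁻ z, g z ∂((P.map Z).prod (P.map D)) := by
        rw [← hprod, lintegral_map hg (hZ.prodMk hD)]
    _ = ∫⁻ z, ∫⁻ d, g (z, d) ∂(P.map D) ∂(P.map Z) := lintegral_prod _ hg.aemeasurable
    _ = ∫⁻ z, z.1 ∂(P.map Z) := by
        refine lintegral_congr fun z => ?_
        have hgz : Measurable fun d => g (z, d) := hg.comp measurable_prodMk_left
        have hexp : Measurable fun ω => ENNReal.ofReal
            (Real.exp (∑ i, z.2 i * (W s' (e i) ω - W s (e i) ω))) := by
          have := fun i => hW.measurable s (e i)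
          have := fun i => hW.measurable s' (e i)
          fun_prop
        rw [lintegral_map hgz hD]
        simp only [g, D, sub_eq_add_neg (∑ i, _), Real.exp_add,
          ENNReal.ofReal_mul (Real.exp_pos _).le]
        rw [lintegral_const_mul _ (hexp.mul_const _), lintegral_mul_const _ hexp,
          hW.lintegral_exp_increment h, ← ENNReal.ofReal_mul (Real.exp_pos _).le, ← Real.exp_add]
        simp
    _ = ∫⁻ ω, Y ω ∂P := by rw [lintegral_map measurable_fst hZ]

end IsCylindricalWiener

/-! ### Discrete maximal inequality and time grids -/

/-- A maximal inequality for nonnegative supermartingales, by backward induction. -/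
lemma mul_measure_exists_le_setLIntegral {Ω : Type*} {mΩ : MeasurableSpace Ω} {P : Measure Ω}
    {m : ℕ → MeasurableSpace Ω} (hm : ∀ j, m j ≤ mΩ) (hmono : Monotone m)
    {Z : ℕ → Ω → ℝ≥0∞} (hZ : ∀ j, Measurable[m j] (Z j))
    (hstep : ∀ j A, MeasurableSet[m j] A → ∫⁻ ω in A, Z (j + 1) ω ∂P ≤ ∫⁻ ω in A, Z j ω ∂P)
    (c : ℝ≥0∞) (k j : ℕ) (A : Set Ω) (hA : MeasurableSet[m j] A) :
    c * P (A ∩ {ω | ∃ l ≤ k, c ≤ Z (j + l) ω}) ≤ ∫⁻ ω in A, Z j ω ∂P := by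
  induction k generalizing j A with
  | zero =>
    have hB : MeasurableSet {ω | c ≤ Z j ω} := hm j _ (hZ j measurableSet_Ici)
    calc _ = c * P.restrict A {ω | c ≤ Z j ω} := by
          rw [Measure.restrict_apply hB, Set.inter_comm]; simp
      _ ≤ _ := mul_meas_ge_le_lintegral ((hZ j).mono (hm j) le_rfl) c
  | succ k ih =>
    have hB : MeasurableSet[m j] {ω | c ≤ Z j ω} := hZ j measurableSet_Ici
    set B := {ω | c ≤ Z j ω}
    have hAB : MeasurableSet[m j] (A \ B) := @MeasurableSet.diff _ (m j) _ _ hA hB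
    -- Either the level is reached at time `j` itself, or the path lies in `A \ B`, which is known
    -- at time `j`, and the level is reached from `j + 1` on. Allowing an arbitrary event `A` of the
    -- past lets the induction close.
    have hsub : A ∩ {ω | ∃ l ≤ k + 1, c ≤ Z (j + l) ω}
        ⊆ (A ∩ B) ∪ ((A \ B) ∩ {ω | ∃ l ≤ k, c ≤ Z (j + 1 + l) ω}) := by
      rintro ω ⟨hωA, l, hl, hω⟩
      by_cases hωB : ω ∈ B
      · exact Or.inl ⟨hωA, hωB⟩
      · refine Or.inr ⟨⟨hωA, hωB⟩, ?_⟩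
        rcases l with _ | l
        · exact absurd hω hωB
        · exact ⟨l, by omega, by rwa [show j + 1 + l = j + (l + 1) by ring]⟩
    have h1 : c * P (A ∩ B) ≤ ∫⁻ ω in A ∩ B, Z j ω ∂P := by
      rw [← setLIntegral_const]
      exact setLIntegral_mono ((hZ j).mono (hm j) le_rfl) fun ω hω => hω.2
    have h2 := (ih (j + 1) (A \ B) (hmono (Nat.le_succ j) _ hAB)).trans (hstep j _ hAB)
    calc _ ≤ c * (P (A ∩ B) + P ((A \ B) ∩ {ω | ∃ l ≤ k, c ≤ Z (j + 1 + l) ω})) := by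
          gcongr
          exact (measure_mono hsub).trans (measure_union_le _ _)
      _ ≤ ∫⁻ ω in A ∩ B, Z j ω ∂P + ∫⁻ ω in A \ B, Z j ω ∂P := by
          rw [mul_add]; exact add_le_add h1 h2
      _ = ∫⁻ ω in A, Z j ω ∂P := lintegral_inter_add_sdiff _ _ (hm j _ hB)

/-- The points of a finite set of times can be enumerated by a monotone sequence without gaps. -/
lemma Finset.exists_monotone_grid (E : Finset ℝ≥0) (h0 : 0 ∈ E) :
    ∃ (τ : ℕ → ℝ≥0) (N : ℕ), Monotone τ ∧ τ 0 = 0 ∧ (∀ x ∈ E, ∃ l ≤ N, τ l = x) ∧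
      ∀ x ∈ E, ∀ j, x ≤ τ j ∨ τ (j + 1) ≤ x := by
  have hc : 0 < E.card := Finset.card_pos.2 ⟨0, h0⟩
  -- Clamping the index makes `τ` constant after the largest point, so it stays monotone on all of
  -- `ℕ`.
  let τ : ℕ → ℝ≥0 := fun j => E.orderEmbOfFin rfl ⟨min j (E.card - 1), by omega⟩
  have hmono : Monotone τ := fun i j hij => by
    refine (E.orderEmbOfFin rfl).monotone ?_
    simp only [Fin.mk_le_mk]
    omega
  have hmem : ∀ x ∈ E, ∃ l ≤ E.card - 1, τ l = x := fun x hx => by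
    have : x ∈ Set.range (E.orderEmbOfFin rfl) := by rw [E.range_orderEmbOfFin rfl]; exact hx
    obtain ⟨i, rfl⟩ := this
    refine ⟨i, by omega, ?_⟩
    simp only [τ]
    congr 1
    ext
    simp only
    omega
  refine ⟨τ, E.card - 1, hmono, ?_, hmem, fun x hx j => ?_⟩
  · obtain ⟨l, -, hl⟩ := hmem 0 h0
    exact le_antisymm (hl ▸ hmono (Nat.zero_le l)) zero_le
  · obtain ⟨l, -, rfl⟩ := hmem x hx
    rcases le_or_gt l j with h | h
    · exact Or.inl (hmono h)
    · exact Or.inr (hmono h)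

/-! ### Lebesgue measure on the half line -/

lemma lebesgueHalfLine_eq_map :
    Measure.map ((↑) : ℝ≥0 → ℝ) lebesgueHalfLine = volume.restrict (Set.Ici 0) := by
  have : MeasurableEmbedding ((↑) : ℝ≥0 → ℝ) :=
    (MeasurableEmbedding.subtype_coe (measurableSet_Ici (a := (0 : ℝ))))
  rw [lebesgueHalfLine, this.map_comap]
  congr 1
  exact Subtype.range_coe

lemma lebesgueHalfLine_Ioc (a b : ℝ≥0) :
    lebesgueHalfLine (Set.Ioc a b) = ENNReal.ofReal ((b : ℝ) - a) := by
  have : MeasurableEmbedding ((↑) : ℝ≥0 → ℝ) :=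
    (MeasurableEmbedding.subtype_coe (measurableSet_Ici (a := (0 : ℝ))))
  rw [lebesgueHalfLine, this.comap_apply]
  have h : ((↑) : ℝ≥0 → ℝ) '' Set.Ioc a b = Set.Ioc (a : ℝ) b := by
    ext x
    constructor
    · rintro ⟨y, hy, rfl⟩
      exact ⟨by exact_mod_cast hy.1, by exact_mod_cast hy.2⟩
    · rintro ⟨h1, h2⟩
      exact ⟨⟨x, a.2.trans h1.le⟩, ⟨by exact_mod_cast h1, by exact_mod_cast h2⟩, rfl⟩
  rw [h, Real.volume_Ioc]

instance : SigmaFinite lebesgueHalfLine :=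
  SigmaFinite.of_map _ measurable_coe_nnreal_real.aemeasurable
    (by rw [lebesgueHalfLine_eq_map]; infer_instance)

/-! ### Algebra of simple integrands -/

namespace SimpleIntegrand

variable {Ω Ξ : Type*} {mΩ : MeasurableSpace Ω} {𝓕 : Filtration ℝ≥0 mΩ}

section
variable {K : Type*} [NormedAddCommGroup K] [InnerProductSpace ℝ K]

/-- The integrand truncated at the deterministic time `s`. -/
noncomputable def truncate (s : ℝ≥0) (Ψ : SimpleIntegrand 𝓕 Ξ K) : SimpleIntegrand 𝓕 Ξ K where
  n := Ψ.n
  a i := min (Ψ.a i) s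
  b i := min (Ψ.b i) s
  le i := min_le_min_right _ (Ψ.le i)
  -- For `a i > s` the new left endpoint is `s`, where `c i` need not be measurable. The truncated
  -- interval is then empty, so the value zero costs nothing.
  c i ω := if Ψ.a i ≤ s then Ψ.c i ω else 0
  measurable i := by
    split_ifs with h
    · rw [min_eq_left h]; exact Ψ.measurable i
    · exact @measurable_const _ _ _ (𝓕 _) _
  bounded i := by
    split_ifs with h
    · exact Ψ.bounded i
    · exact ⟨0, fun ω => by simp⟩
  e := Ψ.e
  k := Ψ.k

/-- The difference of two simple integrands. -/
noncomputable def sub (Ψ Ψ' : SimpleIntegrand 𝓕 Ξ K) : SimpleIntegrand 𝓕 Ξ K where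
  n := Ψ.n + Ψ'.n
  a := Fin.append Ψ.a Ψ'.a
  b := Fin.append Ψ.b Ψ'.b
  le i := by refine Fin.addCases (fun i => ?_) (fun i => ?_) i <;> simp [Ψ.le, Ψ'.le]
  c := Fin.append Ψ.c Ψ'.c
  measurable i := by
    refine Fin.addCases (fun i => ?_) (fun i => ?_) i
    · rw [Fin.append_left, Fin.append_left]; exact Ψ.measurable i
    · rw [Fin.append_right, Fin.append_right]; exact Ψ'.measurable i
  bounded i := by
    refine Fin.addCases (fun i => ?_) (fun i => ?_) i <;> simp [Ψ.bounded, Ψ'.bounded]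
  e := Fin.append Ψ.e Ψ'.e
  k := Fin.append Ψ.k (fun i => -Ψ'.k i)

/-- The image of a simple integrand under the functional `⟨k, ·⟩`. -/
noncomputable def innerWith (k : K) (Ψ : SimpleIntegrand 𝓕 Ξ K) : SimpleIntegrand 𝓕 Ξ ℝ where
  __ := Ψ
  k i := inner ℝ k (Ψ.k i)

lemma integral_truncate (s : ℝ≥0) (Ψ : SimpleIntegrand 𝓕 Ξ K) (W : ℝ≥0 → Ξ → Ω → ℝ) (ω : Ω) :
    (Ψ.truncate s).integral W ω = ∑ i, (Ψ.c i ω * (W (min (Ψ.b i) s) (Ψ.e i) ω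
      - W (min (Ψ.a i) s) (Ψ.e i) ω)) • Ψ.k i := by
  refine Finset.sum_congr rfl fun i _ => ?_
  simp only [truncate]
  split_ifs with h
  · rfl
  · have h' := (not_le.1 h).le
    rw [min_eq_right h', min_eq_right (h'.trans (Ψ.le i))]
    simp

lemma integral_sub (Ψ Ψ' : SimpleIntegrand 𝓕 Ξ K) (W : ℝ≥0 → Ξ → Ω → ℝ) (ω : Ω) :
    (Ψ.sub Ψ').integral W ω = Ψ.integral W ω - Ψ'.integral W ω := by
  change ∑ i : Fin (Ψ.n + Ψ'.n), _ = _
  rw [Fin.sum_univ_add]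
  simp [sub, integral, sub_eq_add_neg]

lemma integral_innerWith (k : K) (Ψ : SimpleIntegrand 𝓕 Ξ K) (W : ℝ≥0 → Ξ → Ω → ℝ) (ω : Ω) :
    (Ψ.innerWith k).integral W ω = inner ℝ k (Ψ.integral W ω) := by
  simp only [integral, inner_sum, inner_smul_right]
  rfl

/-- Beyond all right endpoints truncation changes nothing; hence a maximal inequality over
truncation times also controls the full integral. -/
lemma exists_truncate_integral_eq (Ψ : SimpleIntegrand 𝓕 Ξ K) (W : ℝ≥0 → Ξ → Ω → ℝ) :
    ∃ s, ∀ ω, (Ψ.truncate s).integral W ω = Ψ.integral W ω := by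
  refine ⟨∑ i, Ψ.b i, fun ω => ?_⟩
  have hb : ∀ i, Ψ.b i ≤ ∑ i, Ψ.b i := fun i =>
    Finset.single_le_sum (fun _ _ => zero_le) (Finset.mem_univ i)
  rw [integral_truncate]
  refine Finset.sum_congr rfl fun i _ => ?_
  rw [min_eq_left (hb i), min_eq_left ((Ψ.le i).trans (hb i))]

variable [NormedAddCommGroup Ξ] [InnerProductSpace ℝ Ξ]

lemma val_truncate (s : ℝ≥0) (Ψ : SimpleIntegrand 𝓕 Ξ K) (σ : ℝ≥0) (ω : Ω) :
    (Ψ.truncate s).val σ ω = (Set.Iic s).indicator (fun σ => Ψ.val σ ω) σ := by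
  by_cases hσ : σ ∈ Set.Iic s
  · rw [Set.indicator_of_mem hσ]
    refine Finset.sum_congr rfl fun i _ => ?_
    have hσ' : σ ≤ s := hσ
    simp only [truncate, Set.indicator_apply, Set.mem_Ioc, le_min_iff, hσ', and_true]
    by_cases h : Ψ.a i ≤ s
    · simp [h]
    · have h1 : ¬ Ψ.a i < σ := fun h1 => h (h1.le.trans hσ')
      simp [h, h1]
  · rw [Set.indicator_of_notMem hσ]
    refine Finset.sum_eq_zero fun i _ => Set.indicator_of_notMem ?_ _
    exact fun h => hσ (h.2.trans (min_le_right _ _))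

lemma val_sub (Ψ Ψ' : SimpleIntegrand 𝓕 Ξ K) (σ : ℝ≥0) (ω : Ω) :
    (Ψ.sub Ψ').val σ ω = Ψ.val σ ω - Ψ'.val σ ω := by
  change ∑ i : Fin (Ψ.n + Ψ'.n), _ = _
  rw [Fin.sum_univ_add, val, val, sub_eq_add_neg, ← Finset.sum_neg_distrib]
  congr 1
  · simp [sub]
  · refine Finset.sum_congr rfl fun i _ => ?_
    simp only [sub, Fin.append_right, Set.indicator_apply]
    split_ifs
    · ext; simp
    · simp

lemma val_innerWith (k : K) (Ψ : SimpleIntegrand 𝓕 Ξ K) (σ : ℝ≥0) (ω : Ω) :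
    (Ψ.innerWith k).val σ ω = (innerSL ℝ k).comp (Ψ.val σ ω) := by
  ext ξ
  simp only [val, innerWith, _root_.sum_apply, ContinuousLinearMap.comp_apply, map_sum]
  refine Finset.sum_congr rfl fun i _ => ?_
  simp only [Set.indicator_apply]
  split_ifs
  · simp
  · simp

end

/-- The coefficients of the `i`-th term of a scalar integrand on an interval `(s, s']` without
jumps. -/
noncomputable def coeff (Ψ : SimpleIntegrand 𝓕 Ξ ℝ) (s s' : ℝ≥0) (i : Fin Ψ.n) (ω : Ω) : ℝ :=
  if Ψ.a i ≤ s ∧ s' ≤ Ψ.b i then Ψ.c i ω * Ψ.k i else 0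

lemma measurable_coeff (Ψ : SimpleIntegrand 𝓕 Ξ ℝ) (s s' : ℝ≥0) (i : Fin Ψ.n) :
    Measurable[𝓕 s] (Ψ.coeff s s' i) := by
  unfold coeff
  split_ifs with h
  · exact ((Ψ.measurable i).mono (𝓕.mono h.1) le_rfl).mul_const _
  · exact @measurable_const _ _ _ (𝓕 _) _

/-- No endpoint lies strictly between `s` and `s'`, so each term is either active on the whole cell
or absent from it. -/
lemma integral_truncate_sub (Ψ : SimpleIntegrand 𝓕 Ξ ℝ) (W : ℝ≥0 → Ξ → Ω → ℝ) {s s' : ℝ≥0}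
    (hs : s ≤ s')
    (ha : ∀ i, Ψ.a i ≤ s ∨ s' ≤ Ψ.a i) (hb : ∀ i, Ψ.b i ≤ s ∨ s' ≤ Ψ.b i) (ω : Ω) :
    (Ψ.truncate s').integral W ω - (Ψ.truncate s).integral W ω
      = ∑ i, Ψ.coeff s s' i ω * (W s' (Ψ.e i) ω - W s (Ψ.e i) ω) := by
  rw [integral_truncate, integral_truncate, ← Finset.sum_sub_distrib]
  refine Finset.sum_congr rfl fun i _ => ?_
  simp only [coeff, smul_eq_mul]
  split_ifs with h
  · rw [min_eq_right h.2, min_eq_left (h.1.trans hs), min_eq_left h.1, min_eq_right (hs.trans h.2)]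
    ring
  · have hle := Ψ.le i
    rcases hb i with h1 | h1
    · rw [min_eq_left h1, min_eq_left (h1.trans hs), min_eq_left (hle.trans h1),
        min_eq_left ((hle.trans h1).trans hs)]
      ring
    · have h2 : s' ≤ Ψ.a i := (ha i).resolve_left fun h' => h ⟨h', h1⟩
      rw [min_eq_right h1, min_eq_right h2, min_eq_right (hs.trans h1), min_eq_right (hs.trans h2)]
      ring

variable [NormedAddCommGroup Ξ] [InnerProductSpace ℝ Ξ]

lemma val_eq_coeff (Ψ : SimpleIntegrand 𝓕 Ξ ℝ) {s s' : ℝ≥0}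
    (ha : ∀ i, Ψ.a i ≤ s ∨ s' ≤ Ψ.a i) (hb : ∀ i, Ψ.b i ≤ s ∨ s' ≤ Ψ.b i) {σ : ℝ≥0}
    (hσ : σ ∈ Set.Ioc s s') (ω : Ω) :
    Ψ.val σ ω = innerSL ℝ (∑ i, Ψ.coeff s s' i ω • Ψ.e i) := by
  rw [map_sum, val]
  refine Finset.sum_congr rfl fun i _ => ?_
  have : σ ∈ Set.Ioc (Ψ.a i) (Ψ.b i) ↔ Ψ.a i ≤ s ∧ s' ≤ Ψ.b i := by
    have := ha i; have := hb i
    simp only [Set.mem_Ioc] at *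
    grind
  simp only [coeff, Set.indicator_apply, this]
  split_ifs
  · ext ξ; simp; ring
  · simp

/-- The quadratic variation of the stochastic integral of a scalar simple integrand. -/
noncomputable def energy (Ψ : SimpleIntegrand 𝓕 Ξ ℝ) (ω : Ω) : ℝ≥0∞ :=
  ∫⁻ σ, ‖Ψ.val σ ω‖ₑ ^ 2 ∂lebesgueHalfLine

/-- On each grid cell the integrand is constant, so the sum is the energy over the cells covered.
Only an inequality remains because the cells need not exhaust the half line. -/
lemma sum_grid_le_energy (Ψ : SimpleIntegrand 𝓕 Ξ ℝ) {τ : ℕ → ℝ≥0} (hτ : Monotone τ)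
    (ha : ∀ i j, Ψ.a i ≤ τ j ∨ τ (j + 1) ≤ Ψ.a i) (hb : ∀ i j, Ψ.b i ≤ τ j ∨ τ (j + 1) ≤ Ψ.b i)
    (N : ℕ) (ω : Ω) :
    ENNReal.ofReal (∑ l ∈ Finset.range N, ((τ (l + 1) : ℝ) - τ l)
      * ‖∑ i, Ψ.coeff (τ l) (τ (l + 1)) i ω • Ψ.e i‖ ^ 2) ≤ Ψ.energy ω := by
  have hnn : ∀ l, 0 ≤ (τ (l + 1) : ℝ) - τ l := fun l =>
    sub_nonneg.2 (by exact_mod_cast hτ (Nat.le_succ l))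
  rw [ENNReal.ofReal_sum_of_nonneg fun l _ => mul_nonneg (hnn l) (sq_nonneg _)]
  calc _ = ∑ l ∈ Finset.range N, ∫⁻ σ in Set.Ioc (τ l) (τ (l + 1)),
        ‖Ψ.val σ ω‖ₑ ^ 2 ∂lebesgueHalfLine := by
        refine Finset.sum_congr rfl fun l _ => ?_
        rw [setLIntegral_congr_fun measurableSet_Ioc (g := fun _ =>
          ‖∑ i, Ψ.coeff (τ l) (τ (l + 1)) i ω • Ψ.e i‖ₑ ^ 2) fun σ hσ => ?_]
        · rw [setLIntegral_const, lebesgueHalfLine_Ioc, mul_comm, ENNReal.ofReal_mul (by positivity),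
            ENNReal.ofReal_pow (norm_nonneg _), ofReal_norm]
        · simp only
          rw [Ψ.val_eq_coeff (fun i => ha i l) (fun i => hb i l) hσ, ← ofReal_norm,
            innerSL_apply_norm, ofReal_norm]
    _ = ∫⁻ σ in ⋃ l ∈ Finset.range N, Set.Ioc (τ l) (τ (l + 1)),
        ‖Ψ.val σ ω‖ₑ ^ 2 ∂lebesgueHalfLine := by
        rw [lintegral_biUnion_finset ?_ fun _ _ => measurableSet_Ioc]
        exact fun i _ j _ hij => hτ.pairwise_disjoint_on_Ioc_succ hij
    _ ≤ _ := setLIntegral_le_lintegral _ _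

/-! ### Exponential tail bounds for simple integrands -/

variable {P : Measure Ω} [IsProbabilityMeasure P] [P.IsComplete] {W : ℝ≥0 → Ξ → Ω → ℝ}
  {hW : IsCylindricalWiener W P}

/-- Exponential maximal inequality for stochastic integrals of simple integrands, one sided. -/
lemma measure_exists_le_integral_truncate_and (Ψ : SimpleIntegrand (wienerFiltration hW) Ξ ℝ)
    (D : Finset ℝ≥0) (a : ℝ) {b : ℝ} (hb0 : 0 ≤ b) (r : ℝ) :
    P {ω | (∃ s ∈ D, a ≤ r * (Ψ.truncate s).integral W ω) ∧ Ψ.energy ω ≤ ENNReal.ofReal b}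
      ≤ ENNReal.ofReal (Real.exp (r ^ 2 * b / 2 - a)) := by
  classical
  obtain ⟨τ, N, hτ, hτ0, hτD, hgap⟩ := Finset.exists_monotone_grid
    (insert 0 (D ∪ Finset.univ.image Ψ.a ∪ Finset.univ.image Ψ.b)) (by simp)
  have ha : ∀ i j, Ψ.a i ≤ τ j ∨ τ (j + 1) ≤ Ψ.a i := fun i j => hgap _ (by simp) j
  have hb : ∀ i j, Ψ.b i ≤ τ j ∨ τ (j + 1) ≤ Ψ.b i := fun i j => hgap _ (by simp) j
  let v : ℕ → Ω → Ξ := fun l ω => ∑ i, Ψ.coeff (τ l) (τ (l + 1)) i ω • Ψ.e i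
  let inc : ℕ → Ω → ℝ := fun l ω =>
    ∑ i, (r * Ψ.coeff (τ l) (τ (l + 1)) i ω) * (W (τ (l + 1)) (Ψ.e i) ω - W (τ l) (Ψ.e i) ω)
      - ((τ (l + 1) : ℝ) - τ l) * ‖∑ i, (r * Ψ.coeff (τ l) (τ (l + 1)) i ω) • Ψ.e i‖ ^ 2 / 2
  -- The exponential martingale sampled on the grid: each step multiplies by a factor of conditional
  -- mean one.
  let Z : ℕ → Ω → ℝ≥0∞ := fun j ω =>
    ENNReal.ofReal (Real.exp (∑ l ∈ Finset.range j, inc l ω))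
  have hcoef : ∀ l i, Measurable[wienerFiltration hW (τ l)]
      fun ω => r * Ψ.coeff (τ l) (τ (l + 1)) i ω := fun l i =>
    (Ψ.measurable_coeff _ _ i).const_mul r
  have hWm : ∀ {u v : ℝ≥0} (_ : u ≤ v) (ξ : Ξ), Measurable[wienerFiltration hW v] (W u ξ) := by
    intro u v huv ξ
    have h1 : Measurable[MeasurableSpace.comap (W u ξ) (borel ℝ)] (W u ξ) := by
      rw [← BorelSpace.measurable_eq (α := ℝ)]
      exact comap_measurable _
    refine h1.mono ?_ le_rfl
    exact le_sup_of_le_left (le_iSup_of_le u (le_iSup_of_le huv (le_iSup_of_le ξ le_rfl)))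
  have hinc : ∀ l, Measurable[wienerFiltration hW (τ (l + 1))] (inc l) := by
    intro l
    have h1 : ∀ i, Measurable[wienerFiltration hW (τ (l + 1))]
      fun ω => r * Ψ.coeff (τ l) (τ (l + 1)) i ω := fun i =>
        (hcoef l i).mono ((wienerFiltration hW).mono (hτ (Nat.le_succ l))) le_rfl
    have h2 : ∀ i, Measurable[wienerFiltration hW (τ (l + 1))] (W (τ (l + 1)) (Ψ.e i)) :=
      fun i => hWm le_rfl _
    have h3 : ∀ i, Measurable[wienerFiltration hW (τ (l + 1))] (W (τ l) (Ψ.e i)) :=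
      fun i => hWm (hτ (Nat.le_succ l)) _
    have hcont : Measurable fun y : Fin Ψ.n → ℝ => ‖∑ i, y i • Ψ.e i‖ :=
      Continuous.measurable (by fun_prop)
    have h4 : Measurable[wienerFiltration hW (τ (l + 1))]
        fun ω => ‖∑ i, (r * Ψ.coeff (τ l) (τ (l + 1)) i ω) • Ψ.e i‖ :=
      hcont.comp (@measurable_pi_lambda _ _ _ (wienerFiltration hW (τ (l + 1))) _
        (fun ω i => r * Ψ.coeff (τ l) (τ (l + 1)) i ω) h1)
    refine Measurable.sub ?_ ?_
    · exact Finset.measurable_fun_sum _ fun i _ => (h1 i).mul ((h2 i).sub (h3 i))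
    · exact ((h4.pow_const 2).const_mul _).div_const 2
  have hZ : ∀ j, Measurable[wienerFiltration hW (τ j)] (Z j) := fun j => by
    refine ENNReal.measurable_ofReal.comp (Real.measurable_exp.comp ?_)
    refine Finset.measurable_fun_sum _ fun l hl => (hinc l).mono
      ((wienerFiltration hW).mono (hτ ?_)) le_rfl
    simpa using hl
  have hstep : ∀ j A, MeasurableSet[wienerFiltration hW (τ j)] A →
      ∫⁻ ω in A, Z (j + 1) ω ∂P ≤ ∫⁻ ω in A, Z j ω ∂P := by
    intro j A hA
    have hA' := (wienerFiltration hW).le _ _ hA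
    have hY : Measurable[wienerFiltration hW (τ j)] (A.indicator (Z j)) := (hZ j).indicator hA
    rw [← lintegral_indicator hA', ← lintegral_indicator hA']
    refine le_of_eq (Eq.trans (lintegral_congr fun ω => ?_)
      (hW.lintegral_mul_exp_increment (hτ (Nat.le_succ j)) Ψ.e (hcoef j) hY))
    by_cases hω : ω ∈ A
    · simp only [Set.indicator_of_mem hω, Z, Finset.sum_range_succ, Real.exp_add]
      rw [ENNReal.ofReal_mul (Real.exp_pos _).le]
    · simp [Set.indicator_of_notMem hω]
  have hint : ∀ j ω, (Ψ.truncate (τ j)).integral W ω = ∑ l ∈ Finset.range j,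
      ∑ i, Ψ.coeff (τ l) (τ (l + 1)) i ω * (W (τ (l + 1)) (Ψ.e i) ω - W (τ l) (Ψ.e i) ω) := by
    intro j ω
    have h0 : (Ψ.truncate (τ 0)).integral W ω = 0 := by
      simp [integral_truncate, hτ0]
    rw [← sub_zero (integral _ _ _), ← h0,
      ← Finset.sum_range_sub (fun j => (Ψ.truncate (τ j)).integral W ω)]
    exact Finset.sum_congr rfl fun l _ =>
      Ψ.integral_truncate_sub W (hτ (Nat.le_succ l)) (fun i => ha i l) (fun i => hb i l) ω
  have hsum : ∀ j ω, ∑ l ∈ Finset.range j, inc l ω = r * (Ψ.truncate (τ j)).integral W ω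
      - r ^ 2 / 2 * ∑ l ∈ Finset.range j, ((τ (l + 1) : ℝ) - τ l) * ‖v l ω‖ ^ 2 := by
    intro j ω
    rw [hint, Finset.mul_sum, Finset.mul_sum, ← Finset.sum_sub_distrib]
    refine Finset.sum_congr rfl fun l _ => ?_
    simp only [inc, v, mul_smul, ← Finset.smul_sum, norm_smul, mul_pow, Finset.mul_sum, mul_assoc,
      Real.norm_eq_abs, sq_abs]
    ring
  -- Where the energy is at most `b`, the compensator is at most `r² b / 2`, so `r ∫Ψ dW ≥ a` forces
  -- `Z` above this level.
  have hmax := mul_measure_exists_le_setLIntegral (P := P)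
    (fun j => (wienerFiltration hW).le (τ j)) (fun i j hij => (wienerFiltration hW).mono (hτ hij))
    hZ hstep (ENNReal.ofReal (Real.exp (a - r ^ 2 * b / 2))) N 0 Set.univ
    (@MeasurableSet.univ _ (_))
  have hone : ∫⁻ ω in Set.univ, Z 0 ω ∂P = 1 := by simp [Z]
  rw [hone, Set.univ_inter] at hmax
  have hsub : {ω | (∃ s ∈ D, a ≤ r * (Ψ.truncate s).integral W ω) ∧ Ψ.energy ω ≤ ENNReal.ofReal b}
      ⊆ {ω | ∃ l ≤ N, ENNReal.ofReal (Real.exp (a - r ^ 2 * b / 2)) ≤ Z (0 + l) ω} := by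
    rintro ω ⟨⟨s, hs, hsa⟩, hQ⟩
    obtain ⟨l, hl, rfl⟩ := hτD s (by simp [hs])
    refine ⟨l, hl, ENNReal.ofReal_le_ofReal (Real.exp_le_exp.2 ?_)⟩
    rw [zero_add, hsum]
    have h1 := (Ψ.sum_grid_le_energy hτ ha hb l ω).trans hQ
    rw [ENNReal.ofReal_le_ofReal_iff hb0] at h1
    have := mul_le_mul_of_nonneg_left h1 (by positivity : 0 ≤ r ^ 2 / 2)
    simp only [v]
    linarith
  calc _ ≤ P _ := measure_mono hsub
    _ = ENNReal.ofReal (Real.exp (r ^ 2 * b / 2 - a))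
        * (ENNReal.ofReal (Real.exp (a - r ^ 2 * b / 2)) * P _) := by
        rw [← mul_assoc, ← ENNReal.ofReal_mul (Real.exp_pos _).le, ← Real.exp_add]
        simp
    _ ≤ _ := mul_le_of_le_one_right zero_le hmax

/-- Maximal tail inequality for stochastic integrals of simple integrands. -/
lemma measure_exists_le_abs_integral_truncate (Ψ : SimpleIntegrand (wienerFiltration hW) Ξ ℝ)
    (D : Finset ℝ≥0) {a b : ℝ} (ha : 0 < a) (hb : 0 < b) :
    P {ω | ∃ s ∈ D, a ≤ |(Ψ.truncate s).integral W ω|}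
      ≤ 2 * ENNReal.ofReal (Real.exp (-(a ^ 2 / (2 * b))))
        + P {ω | ENNReal.ofReal b < Ψ.energy ω} := by
  -- The slope `r = ±a/b` minimises the Chernoff exponent `r² b / 2 - |r| a`, with value `-a²/(2b)`.
  have h1 := Ψ.measure_exists_le_integral_truncate_and D (a ^ 2 / b) hb.le (a / b)
  have h2 := Ψ.measure_exists_le_integral_truncate_and D (a ^ 2 / b) hb.le (-(a / b))
  have he : (a / b) ^ 2 * b / 2 - a ^ 2 / b = -(a ^ 2 / (2 * b)) := by
    field_simp; ring
  rw [neg_sq, he] at h2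
  rw [he] at h1
  have hab : 0 < a / b := div_pos ha hb
  have hsub : {ω | ∃ s ∈ D, a ≤ |(Ψ.truncate s).integral W ω|} ⊆
      ({ω | (∃ s ∈ D, a ^ 2 / b ≤ a / b * (Ψ.truncate s).integral W ω) ∧
          Ψ.energy ω ≤ ENNReal.ofReal b} ∪
        {ω | (∃ s ∈ D, a ^ 2 / b ≤ -(a / b) * (Ψ.truncate s).integral W ω) ∧
          Ψ.energy ω ≤ ENNReal.ofReal b}) ∪ {ω | ENNReal.ofReal b < Ψ.energy ω} := by
    rintro ω ⟨s, hs, hω⟩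
    rcases lt_or_ge (ENNReal.ofReal b) (Ψ.energy ω) with h | h
    · exact Or.inr h
    · refine Or.inl ?_
      have hsq : a ^ 2 / b = a / b * a := by ring
      rcases le_abs.1 hω with h' | h'
      · exact Or.inl ⟨⟨s, hs, by rw [hsq]; exact mul_le_mul_of_nonneg_left h' hab.le⟩, h⟩
      · refine Or.inr ⟨⟨s, hs, ?_⟩, h⟩
        rw [hsq, neg_mul, ← mul_neg]
        exact mul_le_mul_of_nonneg_left h' hab.le
  refine (measure_mono hsub).trans ((measure_union_le _ _).trans ?_)
  gcongr
  refine (measure_union_le _ _).trans ?_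
  rw [two_mul]
  exact add_le_add h1 h2

/-- Tail inequality for the stochastic integral of a simple integrand. -/
lemma measure_le_abs_integral (Ψ : SimpleIntegrand (wienerFiltration hW) Ξ ℝ)
    {a b : ℝ} (ha : 0 < a) (hb : 0 < b) :
    P {ω | a ≤ |Ψ.integral W ω|} ≤ 2 * ENNReal.ofReal (Real.exp (-(a ^ 2 / (2 * b))))
        + P {ω | ENNReal.ofReal b < Ψ.energy ω} := by
  obtain ⟨s, hs⟩ := Ψ.exists_truncate_integral_eq W
  simpa [hs] using Ψ.measure_exists_le_abs_integral_truncate {s} ha hb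

end SimpleIntegrand

/-! ### Measurability and elementary estimates -/

/-- The operator norm of a weakly measurable family of operators is measurable. -/
lemma measurable_enorm_of_forall_measurable_apply {α Ξ K : Type*} [MeasurableSpace α]
    [NormedAddCommGroup Ξ] [NormedSpace ℝ Ξ] [TopologicalSpace.SeparableSpace Ξ]
    [NormedAddCommGroup K] [NormedSpace ℝ K] [MeasurableSpace K] [OpensMeasurableSpace K]
    {L : α → Ξ →L[ℝ] K} (hL : ∀ ξ, Measurable fun a => L a ξ) : Measurable fun a => ‖L a‖ₑ := by
  suffices h : Measurable fun a => ‖L a‖ by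
    simpa only [ofReal_norm] using h.ennreal_ofReal
  refine measurable_of_Iic fun r => ?_
  rcases lt_or_ge r 0 with hr | hr
  · convert MeasurableSet.empty
    ext a
    simpa using hr.trans_le (norm_nonneg (L a))
  have : (fun a => ‖L a‖) ⁻¹' Set.Iic r
      = ⋂ n, {a | ‖L a (TopologicalSpace.denseSeq Ξ n)‖ ≤ r * ‖TopologicalSpace.denseSeq Ξ n‖} := by
    ext a
    simp only [Set.mem_preimage, Set.mem_Iic, Set.mem_iInter, Set.mem_ofPred_eq,
      ContinuousLinearMap.opNorm_le_iff hr]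
    refine ⟨fun h n => h _, fun h x => ?_⟩
    refine (TopologicalSpace.denseRange_denseSeq Ξ).induction_on x ?_ h
    exact isClosed_le (by fun_prop) (by fun_prop)
  rw [this]
  exact MeasurableSet.iInter fun n => measurableSet_le (hL _).norm measurable_const

/-- A single unit vector is an orthonormal family. Hilbert–Schmidt convergence of approximations
thus gives operator norm convergence, which suffices for functionals. -/
lemma enorm_sq_le_hsNormSq {Ξ K : Type*} [NormedAddCommGroup Ξ] [InnerProductSpace ℝ Ξ]
    [NormedAddCommGroup K] [InnerProductSpace ℝ K] (L : Ξ →L[ℝ] K) : ‖L‖ₑ ^ 2 ≤ hsNormSq L := by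
  have key : ∀ e : Ξ, ‖e‖ = 1 → ‖L e‖ₑ ^ 2 ≤ hsNormSq L := fun e he => by
    have ho : Orthonormal ℝ (fun x : ({e} : Finset Ξ) => (x : Ξ)) := by
      refine ⟨fun x => ?_, fun x y hxy => absurd (Subsingleton.elim x y) hxy⟩
      simp only [Finset.mem_singleton.1 x.2, he]
    calc _ = ∑ e ∈ ({e} : Finset Ξ), ‖L e‖ₑ ^ 2 := by simp
      _ ≤ _ := le_iSup₂_of_le {e} ho le_rfl
  rcases eq_or_ne (hsNormSq L) ∞ with h | h
  · rw [h]; exact le_top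
  lift hsNormSq L to ℝ≥0 using h with r hr
  have hle : ‖L‖ ≤ Real.sqrt r := by
    refine L.opNorm_le_of_unit_norm (Real.sqrt_nonneg _) fun e he => ?_
    refine Real.le_sqrt_of_sq_le ?_
    have := key e he
    rw [← ofReal_norm, ← ENNReal.ofReal_pow (norm_nonneg _),
      ← ENNReal.ofReal_coe_nnreal] at this
    exact (ENNReal.ofReal_le_ofReal_iff r.2).1 this
  rw [← ofReal_norm, ← ENNReal.ofReal_pow (norm_nonneg _), ← ENNReal.ofReal_coe_nnreal]
  refine ENNReal.ofReal_le_ofReal ?_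
  calc ‖L‖ ^ 2 ≤ Real.sqrt (r : ℝ) ^ 2 := by gcongr
    _ = (r : ℝ) := Real.sq_sqrt r.2

lemma ENNReal.add_sq_le (x y : ℝ≥0∞) : (x + y) ^ 2 ≤ 2 * x ^ 2 + 2 * y ^ 2 := by
  rcases eq_or_ne x ∞ with rfl | hx
  · simp
  rcases eq_or_ne y ∞ with rfl | hy
  · simp
  lift x to ℝ≥0 using hx
  lift y to ℝ≥0 using hy
  norm_cast
  rw [← NNReal.coe_le_coe]
  push_cast
  nlinarith [sq_nonneg ((x : ℝ) - y)]

lemma enorm_sub_sq_le {E : Type*} [SeminormedAddCommGroup E] (x y z : E) :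
    ‖x - y‖ₑ ^ 2 ≤ 2 * ‖z - x‖ₑ ^ 2 + 2 * ‖z - y‖ₑ ^ 2 := by
  have h : ‖x - y‖ₑ ≤ ‖z - x‖ₑ + ‖z - y‖ₑ := by
    rw [← edist_eq_enorm_sub, ← edist_eq_enorm_sub, ← edist_eq_enorm_sub, edist_comm z x]
    exact edist_triangle _ _ _
  exact (pow_le_pow_left' h 2).trans (ENNReal.add_sq_le _ _)

lemma lintegral_lintegral_two_mul_add {α β : Type*} [MeasurableSpace α] [MeasurableSpace β]
    {μ : Measure α} [SFinite μ] {ν : Measure β} {f g : α × β → ℝ≥0∞} (hf : Measurable f)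
    (hg : Measurable g) : ∫⁻ b, ∫⁻ a, (2 * f (a, b) + 2 * g (a, b)) ∂μ ∂ν
      = 2 * ∫⁻ b, ∫⁻ a, f (a, b) ∂μ ∂ν + 2 * ∫⁻ b, ∫⁻ a, g (a, b) ∂μ ∂ν := by
  have hin : ∀ b, ∫⁻ a, (2 * f (a, b) + 2 * g (a, b)) ∂μ
      = 2 * ∫⁻ a, f (a, b) ∂μ + 2 * ∫⁻ a, g (a, b) ∂μ := fun b => by
    have hfb : Measurable fun a => f (a, b) := hf.comp measurable_prodMk_right
    have hgb : Measurable fun a => g (a, b) := hg.comp measurable_prodMk_right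
    rw [lintegral_add_left (hfb.const_mul 2), lintegral_const_mul _ hfb, lintegral_const_mul _ hgb]
  simp only [hin]
  rw [lintegral_add_left (hf.lintegral_prod_left'.const_mul 2),
    lintegral_const_mul _ hf.lintegral_prod_left', lintegral_const_mul _ hg.lintegral_prod_left']

/-- A predictable process is jointly measurable. -/
lemma MeasureTheory.IsStronglyPredictable.stronglyMeasurable_uncurry {Ω E : Type*}
    {mΩ : MeasurableSpace Ω} [TopologicalSpace E] {𝓕 : Filtration ℝ≥0 mΩ} {u : ℝ≥0 → Ω → E}
    (hu : IsStronglyPredictable 𝓕 u) : StronglyMeasurable (Function.uncurry u) := by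
  refine StronglyMeasurable.mono hu (measurableSpace_le_predictable_of_measurableSet
    (fun A hA => ?_) fun i A hA => ?_)
  · exact (measurableSet_singleton _).prod (𝓕.le _ _ hA)
  · exact measurableSet_Ioi.prod (𝓕.le _ _ hA)

lemma MeasureTheory.TendstoInMeasure.of_sub_tendsto_zero {Ω : Type*} {mΩ : MeasurableSpace Ω}
    {P : Measure Ω} {f f' : ℕ → Ω → ℝ} {g : Ω → ℝ} (hf : TendstoInMeasure P f atTop g)
    (h : TendstoInMeasure P (fun n ω => f n ω - f' n ω) atTop 0) :
    TendstoInMeasure P f' atTop g := by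
  rw [tendstoInMeasure_iff_norm] at *
  intro ε hε
  have := (hf (ε / 2) (half_pos hε)).add (h (ε / 2) (half_pos hε))
  rw [add_zero] at this
  refine tendsto_of_tendsto_of_tendsto_of_le_of_le tendsto_const_nhds this (fun _ => zero_le)
    fun n => (measure_mono fun ω hω => ?_).trans (measure_union_le _ _)
  simp only [Set.mem_ofPred_eq, Set.mem_union, Pi.zero_apply, sub_zero, Real.norm_eq_abs] at *
  by_contra! hcon
  have := abs_sub_le (f' n ω) (f n ω) (g ω)
  rw [abs_sub_comm (f' n ω) (f n ω)] at this
  linarith [hcon.1, hcon.2]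

/-! ### Approximation by simple integrands and convergence in probability -/

namespace SimpleIntegrand

variable {Ω Ξ : Type*} {mΩ : MeasurableSpace Ω} {𝓕 : Filtration ℝ≥0 mΩ}
  [NormedAddCommGroup Ξ] [InnerProductSpace ℝ Ξ]

lemma measurable_val_apply (Ψ : SimpleIntegrand 𝓕 Ξ ℝ) (ξ : Ξ) :
    Measurable fun z : ℝ≥0 × Ω => Ψ.val z.1 z.2 ξ := by
  simp only [val, _root_.sum_apply]
  refine Finset.measurable_fun_sum _ fun i _ => ?_
  have h1 : Measurable (fun z : ℝ≥0 × Ω => Ψ.c i z.2 * (inner ℝ (Ψ.e i) ξ * Ψ.k i)) :=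
    ((((Ψ.measurable i).mono (𝓕.le _) le_rfl)).comp measurable_snd).mul_const _
  have h2 : (fun z : ℝ≥0 × Ω => ((Set.Ioc (Ψ.a i) (Ψ.b i)).indicator
      (fun _ => Ψ.c i z.2 • (innerSL ℝ (Ψ.e i)).smulRight (Ψ.k i)) z.1) ξ)
      = (Prod.fst ⁻¹' Set.Ioc (Ψ.a i) (Ψ.b i)).indicator
        (fun z : ℝ≥0 × Ω => Ψ.c i z.2 * (inner ℝ (Ψ.e i) ξ * Ψ.k i)) := by
    ext z
    by_cases hz : z.1 ∈ Set.Ioc (Ψ.a i) (Ψ.b i)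
    · rw [Set.indicator_of_mem hz, Set.indicator_of_mem (Set.mem_preimage.2 hz)]
      simp
    · rw [Set.indicator_of_notMem hz, Set.indicator_of_notMem (fun h => hz (Set.mem_preimage.1 h))]
      simp
  rw [h2]
  exact h1.indicator (measurable_fst measurableSet_Ioc)

variable {P : Measure Ω}

/-- The simple scalar integrands `Ψ n` converge to `φ` in `L²(Ω × [0, ∞); Ξ*)`. -/
structure Approximates (P : Measure Ω) (φ : ℝ≥0 → Ω → Ξ →L[ℝ] ℝ)
    (Ψ : ℕ → SimpleIntegrand 𝓕 Ξ ℝ) : Prop where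
  measurable : ∀ ξ, Measurable fun z : ℝ≥0 × Ω => φ z.1 z.2 ξ
  tendsto : Tendsto (fun n => ∫⁻ ω, ∫⁻ σ, ‖φ σ ω - (Ψ n).val σ ω‖ₑ ^ 2 ∂lebesgueHalfLine ∂P)
    atTop (𝓝 0)

variable {φ : ℝ≥0 → Ω → Ξ →L[ℝ] ℝ} {Ψ Ψ' : ℕ → SimpleIntegrand 𝓕 Ξ ℝ}

lemma Approximates.truncate (h : Approximates P φ Ψ) (s : ℝ≥0) :
    Approximates P (fun σ ω => (Set.Iic s).indicator (fun r => φ r ω) σ)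
      (fun n => (Ψ n).truncate s) where
  measurable ξ := by
    have : (fun z : ℝ≥0 × Ω => ((Set.Iic s).indicator (fun r => φ r z.2) z.1) ξ)
        = (Prod.fst ⁻¹' Set.Iic s).indicator (fun z : ℝ≥0 × Ω => φ z.1 z.2 ξ) := by
      ext z
      by_cases hz : z.1 ∈ Set.Iic s
      · rw [Set.indicator_of_mem hz, Set.indicator_of_mem (Set.mem_preimage.2 hz)]
      · rw [Set.indicator_of_notMem hz, Set.indicator_of_notMem (fun h => hz (Set.mem_preimage.1 h))]
        simp
    rw [this]
    exact (h.measurable ξ).indicator (measurable_fst measurableSet_Iic)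
  tendsto := by
    refine tendsto_of_tendsto_of_tendsto_of_le_of_le tendsto_const_nhds h.tendsto
      (fun _ => zero_le) fun n => lintegral_mono fun ω => lintegral_mono fun σ => ?_
    rw [val_truncate]
    by_cases hσ : σ ∈ Set.Iic s
    · simp [Set.indicator_of_mem hσ]
    · rw [Set.indicator_of_notMem hσ, Set.indicator_of_notMem hσ, sub_zero]
      rw [← ofReal_norm, norm_zero, ENNReal.ofReal_zero, zero_pow two_ne_zero]
      exact zero_le

variable [TopologicalSpace.SeparableSpace Ξ]

lemma measurable_enorm_sub_val {φ : ℝ≥0 → Ω → Ξ →L[ℝ] ℝ}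
    (hφ : ∀ ξ, Measurable fun z : ℝ≥0 × Ω => φ z.1 z.2 ξ) (Ψ : SimpleIntegrand 𝓕 Ξ ℝ) :
    Measurable fun z : ℝ≥0 × Ω => ‖φ z.1 z.2 - Ψ.val z.1 z.2‖ₑ :=
  measurable_enorm_of_forall_measurable_apply fun ξ => (hφ ξ).sub (Ψ.measurable_val_apply ξ)

lemma measurable_energy (Ψ : SimpleIntegrand 𝓕 Ξ ℝ) : Measurable Ψ.energy :=
  Measurable.lintegral_prod_left'
    (f := fun z : ℝ≥0 × Ω => ‖Ψ.val z.1 z.2‖ₑ ^ 2)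
    ((measurable_enorm_of_forall_measurable_apply Ψ.measurable_val_apply).pow_const 2)

lemma Approximates.tendsto_energy_sub (h : Approximates P φ Ψ) (h' : Approximates P φ Ψ') :
    Tendsto (fun n => ∫⁻ ω, ((Ψ n).sub (Ψ' n)).energy ω ∂P) atTop (𝓝 0) := by
  have hlim := (ENNReal.Tendsto.const_mul (a := 2) h.tendsto (Or.inr (by simp))).add
    (ENNReal.Tendsto.const_mul (a := 2) h'.tendsto (Or.inr (by simp)))
  simp only [mul_zero, add_zero] at hlim
  refine tendsto_of_tendsto_of_tendsto_of_le_of_le tendsto_const_nhds hlim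
    (fun _ => zero_le) fun n => ?_
  rw [← lintegral_lintegral_two_mul_add ((measurable_enorm_sub_val h.measurable _).pow_const 2)
    ((measurable_enorm_sub_val h.measurable _).pow_const 2)]
  refine lintegral_mono fun ω => lintegral_mono fun σ => ?_
  simp only [val_sub]
  exact enorm_sub_sq_le _ _ _

variable [IsProbabilityMeasure P] [P.IsComplete] {W : ℝ≥0 → Ξ → Ω → ℝ} {hW : IsCylindricalWiener W P}

/-- The tail bound splits into an exponential term, small once `b` is small, and the probability
that the energy exceeds `b`, which Markov's inequality sends to zero for that fixed `b`. -/
lemma tendstoInMeasure_integral_zero {Θ : ℕ → SimpleIntegrand (wienerFiltration hW) Ξ ℝ}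
    (h : Tendsto (fun n => ∫⁻ ω, (Θ n).energy ω ∂P) atTop (𝓝 0)) :
    TendstoInMeasure P (fun n => (Θ n).integral W) atTop 0 := by
  rw [tendstoInMeasure_iff_norm]
  intro a ha
  rw [ENNReal.tendsto_nhds_zero]
  intro ε hε
  have hexp : Tendsto (fun b : ℝ => 2 * ENNReal.ofReal (Real.exp (-(a ^ 2 / (2 * b)))))
      (𝓝[>] 0) (𝓝 0) := by
    have h1 : Tendsto (fun b : ℝ => -(a ^ 2 / (2 * b))) (𝓝[>] 0) atBot := by
      refine tendsto_neg_atTop_atBot.comp ?_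
      have : (fun b : ℝ => a ^ 2 / (2 * b)) = fun b => (a ^ 2 / 2) * b⁻¹ := by
        ext b; ring
      rw [this]
      exact tendsto_inv_nhdsGT_zero.const_mul_atTop (by positivity)
    have h2 := ENNReal.tendsto_ofReal (Real.tendsto_exp_atBot.comp h1)
    rw [ENNReal.ofReal_zero] at h2
    simpa using ENNReal.Tendsto.const_mul (a := 2) h2 (Or.inr (by simp))
  obtain ⟨b, hbε, hb⟩ := ((ENNReal.tendsto_nhds_zero.1 hexp (ε / 2) (ENNReal.half_pos hε.ne')).and
    self_mem_nhdsWithin).exists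
  have hb' : 0 < ENNReal.ofReal b := ENNReal.ofReal_pos.2 hb
  have hlim : Tendsto (fun n => (∫⁻ ω, (Θ n).energy ω ∂P) / ENNReal.ofReal b) atTop (𝓝 0) := by
    simpa using ENNReal.Tendsto.div_const h (Or.inr hb'.ne')
  filter_upwards [ENNReal.tendsto_nhds_zero.1 hlim (ε / 2) (ENNReal.half_pos hε.ne')] with n hn
  simp only [Pi.zero_apply, sub_zero, Real.norm_eq_abs]
  calc _ ≤ 2 * ENNReal.ofReal (Real.exp (-(a ^ 2 / (2 * b))))
        + P {ω | ENNReal.ofReal b < (Θ n).energy ω} := (Θ n).measure_le_abs_integral ha hb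
    _ ≤ ε / 2 + ε / 2 := by
        refine add_le_add hbε (le_trans ?_ hn)
        refine le_trans (measure_mono fun ω hω => (Set.mem_ofPred_eq ▸ hω : _ < _).le) ?_
        exact meas_ge_le_lintegral_div (Θ n).measurable_energy.aemeasurable hb'.ne'
          ENNReal.ofReal_ne_top
    _ = ε := ENNReal.add_halves ε

/-- The limit in probability does not depend on the approximating sequence, since the difference of
two such sequences has vanishing energy. -/
lemma Approximates.tendstoInMeasure_integral {Ψ Ψ' : ℕ → SimpleIntegrand (wienerFiltration hW) Ξ ℝ}
    (h : Approximates P φ Ψ) (h' : Approximates P φ Ψ') {I : Ω → ℝ}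
    (hI : TendstoInMeasure P (fun n => (Ψ n).integral W) atTop I) :
    TendstoInMeasure P (fun n => (Ψ' n).integral W) atTop I := by
  refine hI.of_sub_tendsto_zero ?_
  refine (tendstoInMeasure_integral_zero (h.tendsto_energy_sub h')).congr_left fun n => ?_
  exact ae_of_all _ fun ω => SimpleIntegrand.integral_sub _ _ _ _

end SimpleIntegrand

/-! ### Scalar projections and uniqueness of the Itô integral -/

namespace IsItoIntegral

open SimpleIntegrand

variable {Ω Ξ K : Type*} {mΩ : MeasurableSpace Ω} {P : Measure Ω}
  [NormedAddCommGroup Ξ] [InnerProductSpace ℝ Ξ] [NormedAddCommGroup K] [InnerProductSpace ℝ K]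
  {W : ℝ≥0 → Ξ → Ω → ℝ} {u v : ℝ≥0} {Φ : ℝ≥0 → Ω → Ξ →L[ℝ] K} {I I' : Ω → K}

/-- Pairing with a fixed `k` reduces a Hilbert space valued integral to a scalar one, where the
exponential bounds apply; mean square convergence is kept only as convergence in probability. -/
lemma exists_approximates {𝓕 : Filtration ℝ≥0 mΩ}
    (h : IsItoIntegral W 𝓕 P u v Φ I) (hWm : ∀ t ξ, Measurable (W t ξ)) (k : K) :
    ∃ Ψ : ℕ → SimpleIntegrand 𝓕 Ξ ℝ,
      Approximates P (fun σ ω => (innerSL ℝ k).comp ((Set.Ioc u v).indicator (fun r => Φ r ω) σ)) Ψ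
      ∧ TendstoInMeasure P (fun n => (Ψ n).integral W) atTop (fun ω => inner ℝ k (I ω)) := by
  obtain ⟨hpred, hI, Ψ, hΨ, hΨI⟩ := h
  have hk : ∀ y : K, ‖inner ℝ k y‖ₑ ≤ ‖k‖ₑ * ‖y‖ₑ := fun y => by
    rw [← ofReal_norm, ← ofReal_norm, ← ofReal_norm, ← ENNReal.ofReal_mul (norm_nonneg _)]
    exact ENNReal.ofReal_le_ofReal (norm_inner_le_norm k y)
  have hktop : ‖k‖ₑ ^ 2 ≠ ∞ := ENNReal.pow_ne_top enorm_ne_top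
  refine ⟨fun n => (Ψ n).innerWith k, ⟨fun ξ => ?_, ?_⟩, ?_⟩
  · have h1 := (hpred ξ).stronglyMeasurable_uncurry
    have h2 := ((innerSL ℝ k).continuous.comp_stronglyMeasurable h1).measurable
    convert h2 using 2 with z
    simp only [Function.uncurry, ContinuousLinearMap.comp_apply,
      Set.indicator_apply]
    split_ifs <;> simp
  · have hlim := ENNReal.Tendsto.const_mul (a := ‖k‖ₑ ^ 2) hΨ (Or.inr hktop)
    rw [mul_zero] at hlim
    refine tendsto_of_tendsto_of_tendsto_of_le_of_le tendsto_const_nhds hlim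
      (fun _ => zero_le) fun n => ?_
    rw [← lintegral_const_mul' _ _ hktop]
    refine lintegral_mono fun ω => ?_
    rw [← lintegral_const_mul' _ _ hktop]
    refine lintegral_mono fun σ => ?_
    simp only
    rw [val_innerWith, ← ContinuousLinearMap.comp_sub]
    refine le_trans ?_ (mul_le_mul_right (enorm_sq_le_hsNormSq _) _)
    rw [← mul_pow]
    gcongr
    rw [← ofReal_norm, ← ofReal_norm, ← ofReal_norm, ← ENNReal.ofReal_mul (norm_nonneg _)]
    refine ENNReal.ofReal_le_ofReal ((ContinuousLinearMap.opNorm_comp_le _ _).trans ?_)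
    rw [innerSL_apply_norm]
  · rw [tendstoInMeasure_iff_enorm]
    intro ε hε hε'
    have hlim := ENNReal.Tendsto.div_const (b := ε ^ 2)
      (ENNReal.Tendsto.const_mul (a := ‖k‖ₑ ^ 2) hΨI (Or.inr hktop))
      (Or.inr (pow_ne_zero 2 hε.ne'))
    rw [mul_zero, ENNReal.zero_div] at hlim
    refine tendsto_of_tendsto_of_tendsto_of_le_of_le tendsto_const_nhds hlim
      (fun _ => zero_le) fun n => ?_
    have hmI : AEMeasurable (fun ω => inner ℝ k (I ω)) P :=
      ((innerSL ℝ k).continuous.comp_aestronglyMeasurable hI).aemeasurable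
    have hmΨ : Measurable (((Ψ n).innerWith k).integral W) := by
      unfold SimpleIntegrand.integral
      refine Finset.measurable_fun_sum _ fun i _ => ?_
      have := ((Ψ n).innerWith k).measurable i |>.mono (𝓕.le _) le_rfl
      exact (this.mul ((hWm _ _).sub (hWm _ _))).mul_const _
    have hmeas : AEMeasurable (fun ω => ‖((Ψ n).innerWith k).integral W ω - inner ℝ k (I ω)‖ₑ ^ 2) P :=
      ((hmΨ.aemeasurable.sub hmI).enorm).pow_const 2
    calc _ ≤ P {ω | ε ^ 2 ≤ ‖((Ψ n).innerWith k).integral W ω - inner ℝ k (I ω)‖ₑ ^ 2} :=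
          measure_mono fun ω hω => pow_le_pow_left' hω 2
      _ ≤ (∫⁻ ω, ‖((Ψ n).innerWith k).integral W ω - inner ℝ k (I ω)‖ₑ ^ 2 ∂P) / ε ^ 2 :=
          meas_ge_le_lintegral_div hmeas (pow_ne_zero 2 hε.ne') (ENNReal.pow_ne_top hε')
      _ ≤ _ := by
          gcongr
          rw [← lintegral_const_mul' _ _ hktop]
          refine lintegral_mono fun ω => ?_
          simp only
          rw [integral_innerWith, ← inner_sub_right, ← mul_pow, ← enorm_neg (I ω - _), neg_sub]
          gcongr
          exact hk _

variable [TopologicalSpace.SeparableSpace Ξ] [IsProbabilityMeasure P] [P.IsComplete]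
  {hW : IsCylindricalWiener W P}

/-- The Ito integral is almost surely unique. -/
lemma ae_eq [TopologicalSpace.SeparableSpace K]
    (h : IsItoIntegral W (wienerFiltration hW) P u v Φ I)
    (h' : IsItoIntegral W (wienerFiltration hW) P u v Φ I') : I =ᵐ[P] I' := by
  have key : ∀ k : K, ∀ᵐ ω ∂P, inner ℝ k (I ω) = inner ℝ k (I' ω) := fun k => by
    obtain ⟨Ψ, hΨ, hI⟩ := h.exists_approximates hW.measurable k
    obtain ⟨Ψ', hΨ', hI'⟩ := h'.exists_approximates hW.measurable k
    exact tendstoInMeasure_ae_unique (hΨ.tendstoInMeasure_integral hΨ' hI) hI'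
  have hall := ae_all_iff.2 fun n => key (TopologicalSpace.denseSeq K n)
  filter_upwards [hall] with ω hω
  refine ext_inner_left ℝ fun k => ?_
  refine (TopologicalSpace.denseRange_denseSeq K).induction_on k ?_ hω
  exact isClosed_eq (by fun_prop) (by fun_prop)

end IsItoIntegral

/-! ### Gaussian maximal tails for Itô integrals -/

namespace IsItoIntegral

open SimpleIntegrand

variable {Ω Ξ : Type*} {mΩ : MeasurableSpace Ω} {P : Measure Ω} [IsProbabilityMeasure P]
  [P.IsComplete] [NormedAddCommGroup Ξ] [InnerProductSpace ℝ Ξ] [TopologicalSpace.SeparableSpace Ξ]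
  {W : ℝ≥0 → Ξ → Ω → ℝ} {hW : IsCylindricalWiener W P} {u v : ℝ≥0} {Φ : ℝ≥0 → Ω → Ξ →L[ℝ] ℝ}
  {M : ℝ≥0 → Ω → ℝ} {β : ℝ}

/-- Maximal tail inequality over finitely many times for an Ito integral whose quadratic variation
is bounded by `β`. -/
lemma measure_exists_le_abs {I : Ω → ℝ} (hI : IsItoIntegral W (wienerFiltration hW) P u v Φ I)
    (hβ : 0 < β)
    (hΦ : ∀ᵐ ω ∂P, ∫⁻ σ in Set.Ioc u v, ‖Φ σ ω‖ₑ ^ 2 ∂lebesgueHalfLine ≤ ENNReal.ofReal β)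
    (D : Finset ℝ≥0) (hD : ∀ s ∈ D, s ≤ v)
    (hM : ∀ s ∈ D, IsItoIntegral W (wienerFiltration hW) P u s Φ (M s)) {a : ℝ} (ha : 0 < a) :
    P {ω | ∃ s ∈ D, 2 * a ≤ |M s ω|}
      ≤ 2 * ENNReal.ofReal (Real.exp (-(a ^ 2 / (8 * β)))) := by
  obtain ⟨Ψ, hΨ, -⟩ := hI.exists_approximates hW.measurable 1
  set φ : ℝ≥0 → Ω → Ξ →L[ℝ] ℝ :=
    fun σ ω => (innerSL ℝ (1 : ℝ)).comp ((Set.Ioc u v).indicator (fun r => Φ r ω) σ)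
  have hone : ∀ L : Ξ →L[ℝ] ℝ, (innerSL ℝ (1 : ℝ)).comp L = L := fun L => by ext; simp
  -- One approximating sequence for `(u, v]`, truncated at `s`, approximates the integrand on `(u,
  -- s]`; so it serves all times of `D` at once.
  have hconv : ∀ s ∈ D, Tendsto (fun n => P {ω | a ≤ |((Ψ n).truncate s).integral W ω - M s ω|})
      atTop (𝓝 0) := fun s hs => by
    obtain ⟨Ψ', hΨ', hMs⟩ := (hM s hs).exists_approximates hW.measurable 1
    have h1 := hΨ.truncate s
    have heq : (fun σ ω => (Set.Iic s).indicator (fun r => φ r ω) σ) = fun σ ω =>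
        (innerSL ℝ (1 : ℝ)).comp ((Set.Ioc u s).indicator (fun r => Φ r ω) σ) := by
      ext1 σ; ext1 ω
      simp only [φ, hone]
      have : σ ∈ Set.Ioc u s ↔ σ ∈ Set.Iic s ∧ σ ∈ Set.Ioc u v := by
        simp only [Set.mem_Ioc, Set.mem_Iic]
        exact ⟨fun h => ⟨h.2, h.1, h.2.trans (hD s hs)⟩, fun h => ⟨h.2.1, h.1⟩⟩
      simp only [Set.indicator_apply, this]
      split_ifs <;> simp_all
    rw [heq] at h1
    have h2 := hΨ'.tendstoInMeasure_integral h1 hMs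
    rw [tendstoInMeasure_iff_norm] at h2
    simpa using h2 a ha
  let X : ℕ → Ω → ℝ≥0∞ := fun n ω => ∫⁻ σ, ‖φ σ ω - (Ψ n).val σ ω‖ₑ ^ 2 ∂lebesgueHalfLine
  have hXm : ∀ n, Measurable (X n) := fun n =>
    ((measurable_enorm_sub_val hΨ.measurable (Ψ n)).pow_const 2).lintegral_prod_left'
  have hβ' : ENNReal.ofReal β ≠ 0 := (ENNReal.ofReal_pos.2 hβ).ne'
  have hX : Tendsto (fun n => P {ω | ENNReal.ofReal β ≤ X n ω}) atTop (𝓝 0) := by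
    have hlim := ENNReal.Tendsto.div_const (b := ENNReal.ofReal β) hΨ.tendsto (Or.inr hβ')
    rw [ENNReal.zero_div] at hlim
    exact tendsto_of_tendsto_of_tendsto_of_le_of_le tendsto_const_nhds hlim
      (fun _ => zero_le) fun n =>
        meas_ge_le_lintegral_div (hXm n).aemeasurable hβ' ENNReal.ofReal_ne_top
  -- If the approximation error `X n` is below `β`, the energy is at most `2β + 2β`. This `4β` is
  -- the origin of the `8β` in the exponent.
  have henergy : ∀ n, P {ω | ENNReal.ofReal (4 * β) < (Ψ n).energy ω}
      ≤ P {ω | ENNReal.ofReal β ≤ X n ω} := fun n => by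
    refine measure_mono_ae ?_
    filter_upwards [hΦ] with ω hω hlt
    change ENNReal.ofReal (4 * β) < (Ψ n).energy ω at hlt
    change ENNReal.ofReal β ≤ X n ω
    by_contra! hcon
    have hφm : Measurable fun σ => ‖φ σ ω‖ₑ ^ 2 :=
      ((measurable_enorm_of_forall_measurable_apply hΨ.measurable).comp
        (measurable_prodMk_right (y := ω))).pow_const 2
    have hdm : Measurable fun σ => ‖φ σ ω - (Ψ n).val σ ω‖ₑ ^ 2 :=
      ((measurable_enorm_sub_val hΨ.measurable (Ψ n)).comp
        (measurable_prodMk_right (y := ω))).pow_const 2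
    have hφ : ∫⁻ σ, ‖φ σ ω‖ₑ ^ 2 ∂lebesgueHalfLine ≤ ENNReal.ofReal β := by
      refine le_trans (le_of_eq ?_) hω
      rw [← lintegral_indicator measurableSet_Ioc]
      refine lintegral_congr fun σ => ?_
      simp only [φ, hone, Set.indicator_apply]
      split_ifs
      · rfl
      · rw [← ofReal_norm, norm_zero, ENNReal.ofReal_zero, zero_pow two_ne_zero]
    have hle : (Ψ n).energy ω ≤ 2 * ∫⁻ σ, ‖φ σ ω‖ₑ ^ 2 ∂lebesgueHalfLine + 2 * X n ω := by
      rw [← lintegral_const_mul _ hφm, ← lintegral_const_mul _ hdm,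
        ← lintegral_add_left (hφm.const_mul 2)]
      refine lintegral_mono fun σ => ?_
      have := enorm_sub_sq_le 0 ((Ψ n).val σ ω) (φ σ ω)
      rwa [zero_sub, enorm_neg, sub_zero] at this
    have : (Ψ n).energy ω ≤ ENNReal.ofReal (4 * β) := by
      refine hle.trans ?_
      calc _ ≤ 2 * ENNReal.ofReal β + 2 * ENNReal.ofReal β := by gcongr
        _ = ENNReal.ofReal (4 * β) := by
          rw [ENNReal.ofReal_mul (by norm_num), ← add_mul]; norm_num
    exact absurd hlt this.not_gt
  have hlim := ((tendsto_const_nhds (x := 2 * ENNReal.ofReal (Real.exp (-(a ^ 2 / (8 * β)))))).add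
    hX).add (tendsto_finsetSum D hconv)
  simp only [add_zero, Finset.sum_const_zero] at hlim
  refine ge_of_tendsto' hlim fun n => ?_
  -- The level `2a` is shared equally between the simple integral and the approximation error.
  have hsub : {ω | ∃ s ∈ D, 2 * a ≤ |M s ω|} ⊆ {ω | ∃ s ∈ D, a ≤ |((Ψ n).truncate s).integral W ω|}
      ∪ ⋃ s ∈ D, {ω | a ≤ |((Ψ n).truncate s).integral W ω - M s ω|} := by
    rintro ω ⟨s, hs, hω⟩
    rcases le_or_gt a |((Ψ n).truncate s).integral W ω| with h | h
    · exact Or.inl ⟨s, hs, h⟩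
    · refine Or.inr (Set.mem_iUnion₂.2 ⟨s, hs, ?_⟩)
      change a ≤ |((Ψ n).truncate s).integral W ω - M s ω|
      have := abs_sub_abs_le_abs_sub (M s ω) (((Ψ n).truncate s).integral W ω)
      rw [abs_sub_comm] at this
      linarith
  refine (measure_mono hsub).trans ((measure_union_le _ _).trans ?_)
  refine add_le_add ?_ (measure_biUnion_finset_le _ _)
  refine ((Ψ n).measure_exists_le_abs_integral_truncate D ha (by positivity : 0 < 4 * β)).trans ?_
  refine add_le_add (le_of_eq ?_) (henergy n)
  congr 4
  ring

/-- Maximal tail inequality over countably many times. -/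
lemma measure_lt_iSup_enorm {I : Ω → ℝ} (hI : IsItoIntegral W (wienerFiltration hW) P u v Φ I)
    (hβ : 0 < β)
    (hΦ : ∀ᵐ ω ∂P, ∫⁻ σ in Set.Ioc u v, ‖Φ σ ω‖ₑ ^ 2 ∂lebesgueHalfLine ≤ ENNReal.ofReal β)
    (d : ℕ → ℝ≥0) (hd : ∀ n, d n ≤ v)
    (hM : ∀ n, IsItoIntegral W (wienerFiltration hW) P u (d n) Φ (M (d n))) {a : ℝ} (ha : 0 < a) :
    P {ω | ENNReal.ofReal (2 * a) < ⨆ n, ‖M (d n) ω‖ₑ}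
      ≤ 2 * ENNReal.ofReal (Real.exp (-(a ^ 2 / (8 * β)))) := by
  classical
  -- A supremum strictly above the level is exceeded by one of its terms, so the event lies in an
  -- increasing union of finite-time events, each with the same bound.
  let E : ℕ → Set Ω := fun N => {ω | ∃ s ∈ (Finset.range N).image d, 2 * a ≤ |M s ω|}
  have hE : Monotone E := fun N N' hN ω ⟨s, hs, h⟩ =>
    ⟨s, Finset.image_mono d (Finset.range_mono hN) hs, h⟩
  have hsub : {ω | ENNReal.ofReal (2 * a) < ⨆ n, ‖M (d n) ω‖ₑ} ⊆ ⋃ N, E N := by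
    intro ω hω
    rw [Set.mem_ofPred_eq] at hω
    obtain ⟨n, hn⟩ := lt_iSup_iff.1 hω
    refine Set.mem_iUnion.2 ⟨n + 1, d n,
      Finset.mem_image_of_mem _ (Finset.mem_range.2 n.lt_succ_self), ?_⟩
    rw [← ofReal_norm, Real.norm_eq_abs] at hn
    exact ((ENNReal.ofReal_le_ofReal_iff (abs_nonneg _)).1 hn.le)
  refine (measure_mono hsub).trans ?_
  rw [hE.measure_iUnion]
  refine iSup_le fun N => hI.measure_exists_le_abs hβ hΦ _ ?_ ?_ ha
  · intro s hs
    obtain ⟨n, -, rfl⟩ := Finset.mem_image.1 hs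
    exact hd n
  · intro s hs
    obtain ⟨n, -, rfl⟩ := Finset.mem_image.1 hs
    exact hM n

end IsItoIntegral

/-! ### From Gaussian tails to moments -/

lemma summable_succ_rpow_mul_exp_neg_sq (q : ℝ) :
    Summable fun k : ℕ => ((k : ℝ) + 1) ^ q * (2 * Real.exp (-((k : ℝ) ^ 2 / 8))) := by
  have h1 := (summable_nat_add_iff 1).2
    (Real.summable_pow_mul_exp_neg_nat_mul ⌈q⌉₊ (by norm_num : (0 : ℝ) < 1 / 8))
  refine Summable.of_nonneg_of_le (fun k => by positivity) (fun k => ?_)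
    (h1.mul_left (2 * Real.exp (1 / 8)))
  have hpow : ((k : ℝ) + 1) ^ q ≤ ((k : ℝ) + 1) ^ ⌈q⌉₊ := by
    rw [← Real.rpow_natCast]
    exact Real.rpow_le_rpow_of_exponent_le (by linarith [Nat.cast_nonneg (α := ℝ) k])
      (Nat.le_ceil q)
  -- This trades the Gaussian factor for a geometric one; the shift from `k` to `k + 1` costs `exp
  -- (1/8)`.
  have hk : (k : ℝ) ≤ (k : ℝ) ^ 2 := by exact_mod_cast Nat.le_self_pow two_ne_zero k
  have hexp : Real.exp (-((k : ℝ) ^ 2 / 8))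
      ≤ Real.exp (1 / 8) * Real.exp (-(1 / 8) * ((k + 1 : ℕ) : ℝ)) := by
    rw [← Real.exp_add]
    refine Real.exp_le_exp.2 ?_
    push_cast
    linarith
  calc _ ≤ ((k : ℝ) + 1) ^ ⌈q⌉₊ *
        (2 * (Real.exp (1 / 8) * Real.exp (-(1 / 8) * ((k + 1 : ℕ) : ℝ)))) := by gcongr
    _ = _ := by push_cast; ring

/-- Moments of a random variable with Gaussian tails at scale `ρ`. -/
lemma exists_forall_lintegral_rpow_le_of_gaussian_tail {q : ℝ} (hq : 1 ≤ q) :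
    ∃ C : ℝ, 0 < C ∧ ∀ {Ω : Type*} {_ : MeasurableSpace Ω} {P : Measure Ω}
      [IsProbabilityMeasure P] {Y : Ω → ℝ≥0∞} (_ : AEMeasurable Y P) {ρ : ℝ} (_ : 0 < ρ)
      (_ : ∀ a : ℝ, 0 < a → P {ω | ENNReal.ofReal (2 * a) < Y ω}
        ≤ 2 * ENNReal.ofReal (Real.exp (-(a ^ 2 / (8 * ρ ^ 2))))),
      (∫⁻ ω, Y ω ^ q ∂P) ^ (1 / q) ≤ ENNReal.ofReal (C * ρ) := by
  have hq0 : 0 < q := by linarith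
  set f : ℕ → ℝ := fun k => ((k : ℝ) + 1) ^ q * (2 * Real.exp (-((k : ℝ) ^ 2 / 8)))
  have hf : Summable f := summable_succ_rpow_mul_exp_neg_sq q
  have hf0 : ∀ k, 0 < f k := fun k => by positivity
  have hS : 0 < ∑' k, f k := hf.tsum_pos (fun k => (hf0 k).le) 0 (hf0 0)
  refine ⟨2 * (∑' k, f k) ^ (1 / q), by positivity, ?_⟩
  intro Ω _ P _ Y hY ρ hρ htail
  -- Layers of width `2ρ`: on `2kρ < Y ≤ 2(k+1)ρ` the single term `c k` dominates `Y ^ q`. The layer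
  -- `k = 0` is the whole space because the tail bound is given only for `a > 0`.
  let B : ℕ → Set Ω := fun k => {ω | k = 0 ∨ ENNReal.ofReal (2 * (k * ρ)) < Y ω}
  have hB : ∀ k, NullMeasurableSet (B k) P := fun k => by
    by_cases hk : k = 0
    · simp [B, hk]
    · simp only [B, hk, false_or]
      exact nullMeasurableSet_lt aemeasurable_const hY
  have hPB : ∀ k, P (B k) ≤ ENNReal.ofReal (2 * Real.exp (-((k : ℝ) ^ 2 / 8))) := fun k => by
    rcases Nat.eq_zero_or_pos k with rfl | hk
    · refine prob_le_one.trans ?_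
      simp
    · have hk' : (0 : ℝ) < k := by exact_mod_cast hk
      have := htail (k * ρ) (by positivity)
      simp only [B, hk.ne', false_or]
      refine this.trans (le_of_eq ?_)
      rw [ENNReal.ofReal_mul zero_le_two, ENNReal.ofReal_ofNat]
      congr 4
      field_simp
  let c : ℕ → ℝ≥0∞ := fun k => ENNReal.ofReal ((2 * ρ) ^ q * ((k : ℝ) + 1) ^ q)
  have hpt : ∀ ω, Y ω ^ q ≤ ∑' k, (B k).indicator (fun _ => c k) ω := fun ω => by
    rcases eq_or_ne (Y ω) ∞ with h | h
    · have : ∀ k, ENNReal.ofReal ((2 * ρ) ^ q) ≤ (B k).indicator (fun _ => c k) ω := fun k => by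
        rw [Set.indicator_of_mem (show ω ∈ B k from Or.inr (by rw [h]; exact ENNReal.ofReal_lt_top))]
        refine ENNReal.ofReal_le_ofReal (le_mul_of_one_le_right (by positivity) ?_)
        exact Real.one_le_rpow (by linarith [Nat.cast_nonneg (α := ℝ) k]) hq0.le
      refine le_trans ?_ (ENNReal.tsum_le_tsum this)
      rw [ENNReal.tsum_const_eq_top_of_ne_zero (ENNReal.ofReal_pos.2 (by positivity)).ne']
      exact le_top
    · obtain ⟨y, hy⟩ : ∃ y : ℝ≥0, Y ω = y := ⟨_, (ENNReal.coe_toNNReal h).symm⟩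
      rcases hn : ⌈(y : ℝ) / (2 * ρ)⌉₊ with _ | k
      · have : (y : ℝ) / (2 * ρ) ≤ 0 := Nat.ceil_eq_zero.1 hn
        have hy0 : (y : ℝ) ≤ 0 := by
          by_contra! hcon
          exact absurd this (not_le.2 (by positivity))
        have : y = 0 := le_antisymm (by exact_mod_cast hy0) zero_le
        rw [hy, this, ENNReal.coe_zero, ENNReal.zero_rpow_of_pos hq0]
        exact zero_le
      · have h1 : (k : ℝ) < (y : ℝ) / (2 * ρ) := Nat.lt_ceil.1 (by omega)
        have h2 : (y : ℝ) / (2 * ρ) ≤ (k : ℝ) + 1 := by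
          have := Nat.le_ceil ((y : ℝ) / (2 * ρ))
          rw [hn] at this
          exact_mod_cast this
        rw [lt_div_iff₀ (by positivity)] at h1
        rw [div_le_iff₀ (by positivity)] at h2
        refine le_trans ?_ (ENNReal.le_tsum k)
        have hmem : ω ∈ B k := by
          refine Or.inr ?_
          rw [hy, ← ENNReal.ofReal_coe_nnreal]
          refine (ENNReal.ofReal_lt_ofReal_iff_of_nonneg (by positivity)).2 ?_
          linarith
        rw [Set.indicator_of_mem hmem, hy, ← ENNReal.ofReal_coe_nnreal,
          ENNReal.ofReal_rpow_of_nonneg y.coe_nonneg hq0.le]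
        refine ENNReal.ofReal_le_ofReal ?_
        rw [← Real.mul_rpow (by positivity) (by positivity)]
        exact Real.rpow_le_rpow y.coe_nonneg (by linarith) hq0.le
  have hint : ∫⁻ ω, Y ω ^ q ∂P ≤ ENNReal.ofReal ((2 * ρ) ^ q * ∑' k, f k) := by
    calc _ ≤ ∫⁻ ω, ∑' k, (B k).indicator (fun _ => c k) ω ∂P := lintegral_mono hpt
      _ = ∑' k, c k * P (B k) := by
          rw [lintegral_tsum fun k => (aemeasurable_const.indicator₀ (hB k))]
          exact tsum_congr fun k => lintegral_indicator_const₀ (hB k) _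
      _ ≤ ∑' k, ENNReal.ofReal ((2 * ρ) ^ q * f k) := by
          refine ENNReal.tsum_le_tsum fun k => ?_
          refine (mul_le_mul_right (hPB k) _).trans (le_of_eq ?_)
          rw [← ENNReal.ofReal_mul (by positivity), mul_assoc]
      _ = _ := by
          rw [← ENNReal.ofReal_tsum_of_nonneg (fun k => by positivity) (hf.mul_left _),
            tsum_mul_left]
  calc _ ≤ (ENNReal.ofReal ((2 * ρ) ^ q * ∑' k, f k)) ^ (1 / q) := by gcongr
    _ = _ := by
      rw [ENNReal.ofReal_rpow_of_nonneg (by positivity) (by positivity),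
        Real.mul_rpow (by positivity) hS.le, ← Real.rpow_mul (by positivity), mul_one_div_cancel hq0.ne',
        Real.rpow_one]
      congr 1
      ring

/-! ### Gronwall inequality and semigroup bound -/

/-- An integral Gronwall inequality with a constant depending only on `b` and `T`. -/
lemma exists_gronwall_const (b T : ℝ≥0) : ∃ K : ℝ≥0, ∀ (t : ℝ≥0) (u : ℝ≥0 → ℝ≥0∞) (a : ℝ≥0),
    t ≤ T → ∫⁻ σ in Set.Ioc t T, u σ ∂lebesgueHalfLine ≠ ∞ →
    (∀ᵐ τ ∂lebesgueHalfLine, τ ∈ Set.Ioc t T →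
      u τ ≤ a + b * ∫⁻ σ in Set.Ioc t τ, u σ ∂lebesgueHalfLine) →
    ∫⁻ σ in Set.Ioc t T, u σ ∂lebesgueHalfLine ≤ K * a := by
  -- On a step of length `δ` the integral term contributes at most half of the left side and can be
  -- absorbed. The number of steps depends only on `b` and `T`.
  let δ : ℝ≥0 := (2 * (b + 1))⁻¹
  have hδ : 0 < δ := by positivity
  have hbδ : (b : ℝ) * δ ≤ 1 / 2 := by
    simp only [δ]
    push_cast
    rw [mul_inv_le_iff₀ (by positivity)]
    linarith
  obtain ⟨N, hN⟩ := exists_nat_ge (T / δ)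
  -- The recursion results from solving `x ≤ c k * a + δ * a + x / 2` for `x`. Only the recursion is
  -- kept, as the first integral vanishes whatever `c 0` is.
  obtain ⟨c, hc⟩ : ∃ c : ℕ → ℝ≥0, ∀ k, c (k + 1) = 2 * c k + 2 * δ :=
    ⟨fun k => Nat.rec 0 (fun _ x => 2 * x + 2 * δ) k, fun k => rfl⟩
  refine ⟨c N, fun t u a htT hfin hu => ?_⟩
  let θ : ℕ → ℝ≥0 := fun k => min (t + k * δ) T
  let g : ℕ → ℝ≥0∞ := fun k => ∫⁻ σ in Set.Ioc t (θ k), u σ ∂lebesgueHalfLine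
  have hθN : θ N = T := by
    refine min_eq_right ?_
    rw [div_le_iff₀ hδ] at hN
    exact hN.trans le_add_self
  have ht : ∀ k, t ≤ θ k := fun k => le_min le_self_add htT
  have hmono : ∀ k, θ k ≤ θ (k + 1) := fun k => by
    refine min_le_min_right _ ?_
    push_cast
    gcongr
    exact le_self_add
  have hlen : ∀ k, (θ (k + 1) : ℝ) - θ k ≤ δ := fun k => by
    have h1 : θ (k + 1) ≤ t + k * δ + δ := (min_le_left _ _).trans (by push_cast; ring_nf; rfl)
    have h2 : θ (k + 1) ≤ T := min_le_right _ _
    have h3 : θ (k + 1) ≤ θ k + δ := by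
      simp only [θ, min_add]
      exact le_min h1 (h2.trans le_self_add)
    have : (θ (k + 1) : ℝ) ≤ θ k + δ := by exact_mod_cast h3
    linarith
  have hgfin : ∀ k, g k ≠ ∞ := fun k =>
    ne_top_of_le_ne_top hfin (lintegral_mono_set (Set.Ioc_subset_Ioc_right (min_le_right _ _)))
  have hg : ∀ k, g k ≤ (c k * a : ℝ≥0) := by
    intro k
    induction k with
    | zero =>
      have : θ 0 = t := by simp [θ, htT]
      simp [g, this]
    | succ k ih =>
      have hsplit : g (k + 1) = g k + ∫⁻ σ in Set.Ioc (θ k) (θ (k + 1)), u σ ∂lebesgueHalfLine := by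
        simp only [g]
        rw [← lintegral_union measurableSet_Ioc, Set.Ioc_union_Ioc_eq_Ioc (ht k) (hmono k)]
        exact Set.Ioc_disjoint_Ioc_of_le le_rfl
      have hinc : ∫⁻ σ in Set.Ioc (θ k) (θ (k + 1)), u σ ∂lebesgueHalfLine
          ≤ (a + b * g (k + 1)) * δ := by
        calc _ ≤ ∫⁻ σ in Set.Ioc (θ k) (θ (k + 1)), (a + b * g (k + 1)) ∂lebesgueHalfLine := by
              refine setLIntegral_mono_ae' measurableSet_Ioc ?_
              filter_upwards [hu] with τ hτ hmem
              refine (hτ ⟨(ht k).trans_lt hmem.1, hmem.2.trans (min_le_right _ _)⟩).trans ?_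
              gcongr
              exact lintegral_mono_set (Set.Ioc_subset_Ioc_right hmem.2)
          _ ≤ _ := by
              rw [setLIntegral_const, lebesgueHalfLine_Ioc]
              gcongr
              rw [← ENNReal.ofReal_coe_nnreal]
              exact ENNReal.ofReal_le_ofReal (hlen k)
      have hle := hsplit.le.trans (add_le_add ih hinc)
      have hx := hgfin (k + 1)
      generalize g (k + 1) = x at hle hx ⊢
      -- Absorption needs a finite `x`; this is where integrability of `u` enters.
      lift x to ℝ≥0 using hx
      norm_cast at hle ⊢
      have hle' : (x : ℝ) ≤ c k * a + (a + b * x) * δ := by exact_mod_cast hle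
      have : (b : ℝ) * δ * x ≤ 1 / 2 * x := mul_le_mul_of_nonneg_right hbδ x.coe_nonneg
      rw [← NNReal.coe_le_coe]
      rw [hc k]
      push_cast
      linarith
  have := hg N
  simp only [g, hθN] at this
  exact_mod_cast this

/-- Orbits are continuous, hence bounded on the compact interval, and the uniform boundedness
principle applies. -/
lemma IsC0Semigroup.exists_norm_le {H : Type*} [NormedAddCommGroup H] [NormedSpace ℝ H]
    [CompleteSpace H] {S : ℝ≥0 → H →L[ℝ] H} (hS : IsC0Semigroup S) (T : ℝ≥0) :
    ∃ M : ℝ≥0, ∀ s ≤ T, ‖S s‖ₑ ≤ M := by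
  obtain ⟨M, hM⟩ := banach_steinhaus (g := fun s : Set.Icc 0 T => S s) fun x => by
    obtain ⟨C, hC⟩ := (isCompact_Icc (a := (0 : ℝ≥0)) (b := T)).exists_bound_of_continuousOn
      (hS.strongly_continuous x).continuousOn
    exact ⟨C, fun s => hC s s.2⟩
  refine ⟨M.toNNReal, fun s hs => ?_⟩
  rw [← ofReal_norm]
  exact ENNReal.ofReal_le_ofReal (hM ⟨s, zero_le, hs⟩)

lemma enorm_le_one_add_rpow {E : Type*} [SeminormedAddGroup E] {p : ℝ} (hp : 1 ≤ p) (x : E) :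
    ‖x‖ₑ ≤ 1 + ‖x‖ₑ ^ p := by
  rcases le_total ‖x‖ₑ 1 with h | h
  · exact h.trans le_self_add
  · refine le_trans ?_ le_add_self
    calc ‖x‖ₑ = ‖x‖ₑ ^ (1 : ℝ) := (ENNReal.rpow_one _).symm
      _ ≤ _ := ENNReal.rpow_le_rpow_of_exponent_le h hp

/-! ### Processes in `𝒮ᵖ` and their directional derivatives -/

namespace MemSp

variable {Ω K : Type*} {mΩ : MeasurableSpace Ω} [NormedAddCommGroup K] {𝓕 : Filtration ℝ≥0 mΩ}
  {P : Measure Ω} {T : ℝ≥0} {p : ℝ} {Y Y' : ℝ≥0 → Ω → K}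

lemma stronglyMeasurable_apply (h : MemSp 𝓕 P T p Y) {τ : ℝ≥0} (hτ : τ ≤ T) :
    StronglyMeasurable (Y τ) := by
  have := h.1.stronglyMeasurable_uncurry.comp_measurable (measurable_prodMk_left (x := τ))
  convert this using 1
  ext ω
  simp [Function.uncurry, Set.mem_Iic.2 hτ]

lemma measurable_enorm_sub (h : MemSp 𝓕 P T p Y) (h' : MemSp 𝓕 P T p Y') :
    Measurable fun z : ℝ≥0 × Ω => ‖(Set.Iic T).indicator (fun r => Y r z.2) z.1
      - (Set.Iic T).indicator (fun r => Y' r z.2) z.1‖ₑ :=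
  (h.1.stronglyMeasurable_uncurry.sub h'.1.stronglyMeasurable_uncurry).enorm

lemma lintegral_enorm_le [IsProbabilityMeasure P] (hp : 1 ≤ p) {τ : ℝ≥0} (hτ : τ ≤ T) :
    ∫⁻ ω, ‖Y τ ω‖ₑ ∂P ≤ 1 + ∫⁻ ω, ⨆ τ ∈ Set.Iic T, ‖Y τ ω‖ₑ ^ p ∂P := by
  calc _ ≤ ∫⁻ ω, (1 + ⨆ τ ∈ Set.Iic T, ‖Y τ ω‖ₑ ^ p) ∂P := lintegral_mono fun ω => by
        refine (enorm_le_one_add_rpow hp _).trans (add_le_add le_rfl ?_)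
        exact le_iSup₂ (f := fun (τ : ℝ≥0) (_ : τ ∈ Set.Iic T) => ‖Y τ ω‖ₑ ^ p) τ hτ
    _ = _ := by rw [lintegral_add_left measurable_const]; simp

end MemSp

/-- The directional derivative of the mild solution is bounded uniformly in `ω`. -/
lemma IsDirectionalDerivSp.ae_enorm_le {Ω H : Type*} {mΩ : MeasurableSpace Ω}
    {P : Measure Ω} [NormedAddCommGroup H] [InnerProductSpace ℝ H] {T : ℝ≥0}
    {𝓕 : Filtration ℝ≥0 mΩ} {p : ℝ} (hp : 1 ≤ p)
    {X : H → ℝ≥0 → Ω → H} {x h : H} {V : ℝ≥0 → Ω → H}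
    (hV : IsDirectionalDerivSp 𝓕 P T p X x h V) {K : ℝ≥0} {τ : ℝ≥0} (hτ : τ ≤ T)
    (hK : ∀ y, ∀ᵐ ω ∂P, ‖X y τ ω - X x τ ω‖ₑ ≤ K * ‖y - x‖ₑ) :
    ∀ᵐ ω ∂P, ‖V τ ω‖ₑ ≤ K * ‖h‖ₑ := by
  have hp0 : 0 < p := by linarith
  have hVm := hV.1.stronglyMeasurable_apply hτ
  -- Subtraction is truncated, so this is the excess of `|V|` over `K |h|`. Difference quotients
  -- have no excess, hence that of `V` is at most its distance to them, whose `p`-th moment tends to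
  -- zero.
  have hzero : ∫⁻ ω, (‖V τ ω‖ₑ - K * ‖h‖ₑ) ^ p ∂P = 0 := by
    refine le_antisymm (ge_of_tendsto hV.2 ?_) zero_le
    filter_upwards [self_mem_nhdsWithin] with ε hε
    have hε : ε ≠ 0 := hε
    refine lintegral_mono_ae ?_
    filter_upwards [hK (x + ε • h)] with ω hω
    refine le_trans ?_ (le_iSup₂ (f := fun (τ : ℝ≥0) (_ : τ ∈ Set.Iic T) =>
      ‖ε⁻¹ • (X (x + ε • h) τ ω - X x τ ω) - V τ ω‖ₑ ^ p) τ hτ)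
    refine ENNReal.rpow_le_rpow ?_ hp0.le
    rw [tsub_le_iff_right]
    have h1 : ‖ε⁻¹ • (X (x + ε • h) τ ω - X x τ ω)‖ₑ ≤ K * ‖h‖ₑ := by
      rw [add_sub_cancel_left, enorm_smul] at hω
      rw [enorm_smul]
      calc _ ≤ ‖ε⁻¹‖ₑ * (K * (‖ε‖ₑ * ‖h‖ₑ)) := by gcongr
        _ = (‖ε⁻¹‖ₑ * ‖ε‖ₑ) * (K * ‖h‖ₑ) := by ring
        _ = _ := by rw [← enorm_mul, inv_mul_cancel₀ hε, enorm_one, one_mul]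
    calc ‖V τ ω‖ₑ = ‖ε⁻¹ • (X (x + ε • h) τ ω - X x τ ω)
          - (ε⁻¹ • (X (x + ε • h) τ ω - X x τ ω) - V τ ω)‖ₑ := by rw [sub_sub_cancel]
      _ ≤ ‖ε⁻¹ • (X (x + ε • h) τ ω - X x τ ω)‖ₑ
          + ‖ε⁻¹ • (X (x + ε • h) τ ω - X x τ ω) - V τ ω‖ₑ := enorm_sub_le
      _ ≤ _ := by rw [add_comm]; gcongr
  rw [lintegral_eq_zero_iff' ((hVm.enorm.sub_const _).pow_const p).aemeasurable] at hzero
  filter_upwards [hzero] with ω hω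
  exact tsub_eq_zero_iff_le.1 ((ENNReal.rpow_eq_zero_iff_of_pos hp0).1 hω)

/-! ### Lipschitz dependence of mild solutions on the initial datum -/

section

variable {Ω H Ξ : Type*} {mΩ : MeasurableSpace Ω} {P : Measure Ω} [IsProbabilityMeasure P]
  [P.IsComplete]
  [NormedAddCommGroup H] [InnerProductSpace ℝ H] [TopologicalSpace.SeparableSpace H]
  [NormedAddCommGroup Ξ] [InnerProductSpace ℝ Ξ] [TopologicalSpace.SeparableSpace Ξ]
  {W : ℝ≥0 → Ξ → Ω → ℝ} {hW : IsCylindricalWiener W P} {T : ℝ≥0}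
  {S : ℝ≥0 → H →L[ℝ] H} {F : ℝ≥0 → H → H} {G : ℝ≥0 → Ξ →L[ℝ] H}

/-- Integral inequality for the difference of two mild solutions. -/
lemma IsMildSolution.ae_enorm_sub_le {p : ℝ} {t : ℝ≥0} {x x' : H} {X X' : ℝ≥0 → Ω → H}
    (hX : IsMildSolution W (wienerFiltration hW) P S F G T p t x X)
    (hX' : IsMildSolution W (wienerFiltration hW) P S F G T p t x' X') {M L : ℝ≥0}
    (hM : ∀ s ≤ T, ‖S s‖ₑ ≤ M) (hL : ∀ s ≤ T, ∀ y z : H, ‖F s y - F s z‖ₑ ≤ L * ‖y - z‖ₑ)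
    {τ : ℝ≥0} (ht : t ≤ τ) (hτ : τ ≤ T) :
    ∀ᵐ ω ∂P, ‖X τ ω - X' τ ω‖ₑ ≤ M * ‖x - x'‖ₑ
      + (M * L : ℝ≥0) * ∫⁻ σ in Set.Ioc t τ, ‖X σ ω - X' σ ω‖ₑ ∂lebesgueHalfLine := by
  obtain ⟨I, hI, hXI⟩ := hX.equation τ ht hτ
  obtain ⟨I', hI', hXI'⟩ := hX'.equation τ ht hτ
  filter_upwards [hI.ae_eq hI', hXI, hXI'] with ω hII' ⟨hf, hXω⟩ ⟨hf', hXω'⟩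
  have hSle : ∀ s ≤ T, ∀ y, ‖S s y‖ₑ ≤ M * ‖y‖ₑ := fun s hs y =>
    ((S s).le_opENorm y).trans (by gcongr; exact hM s hs)
  -- The integrand `e^{(τ-σ)A} G(σ)` is the same for both solutions, so the stochastic convolutions
  -- cancel by uniqueness of the Itô integral.
  have heq : X τ ω - X' τ ω = S (τ - t) (x - x') + ∫ σ in Set.Ioc t τ,
      (S (τ - σ) (F σ (X σ ω)) - S (τ - σ) (F σ (X' σ ω))) ∂lebesgueHalfLine := by
    rw [hXω, hXω', hII', integral_sub hf hf', map_sub]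
    abel
  rw [heq]
  refine (enorm_add_le _ _).trans (add_le_add (hSle _ (tsub_le_self.trans hτ) _) ?_)
  refine (enorm_integral_le_lintegral_enorm _).trans ?_
  rw [← lintegral_const_mul' _ _ ENNReal.coe_ne_top]
  refine setLIntegral_mono' measurableSet_Ioc fun σ hσ => ?_
  rw [← map_sub]
  refine (hSle _ (tsub_le_self.trans hτ) _).trans ?_
  push_cast
  rw [mul_assoc]
  gcongr
  exact hL σ (hσ.2.trans hτ) _ _

/-- Mild solutions depend Lipschitz continuously on the initial datum, uniformly in `ω`. -/
lemma exists_forall_isMildSolution_enorm_sub_le {M L : ℝ≥0} (hM : ∀ s ≤ T, ‖S s‖ₑ ≤ M)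
    (hL : ∀ s ≤ T, ∀ y z : H, ‖F s y - F s z‖ₑ ≤ L * ‖y - z‖ₑ) :
    ∃ K : ℝ≥0, ∀ (p : ℝ) (_ : 1 ≤ p) (t : ℝ≥0) (x x' : H) (X X' : ℝ≥0 → Ω → H)
      (_ : IsMildSolution W (wienerFiltration hW) P S F G T p t x X)
      (_ : IsMildSolution W (wienerFiltration hW) P S F G T p t x' X'),
      ∀ τ, t ≤ τ → τ ≤ T → ∀ᵐ ω ∂P, ‖X τ ω - X' τ ω‖ₑ ≤ K * ‖x - x'‖ₑ := by
  obtain ⟨K, hK⟩ := exists_gronwall_const (M * L) T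
  -- The Gronwall bound `K * M * |x - x'|` for the time integral, inserted once more into the
  -- integral inequality at time `τ`.
  refine ⟨M + M * L * (K * M), fun p hp t x x' X X' hX hX' τ ht hτ => ?_⟩
  have hineq := fun {τ : ℝ≥0} (ht : t ≤ τ) (hτ : τ ≤ T) => hX.ae_enorm_sub_le hX' hM hL ht hτ
  set u : ℝ≥0 × Ω → ℝ≥0∞ := fun z => ‖(Set.Iic T).indicator (fun r => X r z.2) z.1
      - (Set.Iic T).indicator (fun r => X' r z.2) z.1‖ₑ with hu
  have hum : Measurable u := hX.memSp.measurable_enorm_sub hX'.memSp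
  have huX : ∀ σ ≤ T, ∀ ω, u (σ, ω) = ‖X σ ω - X' σ ω‖ₑ := fun σ hσ ω => by
    simp [hu, hσ]
  have hint : ∀ τ ≤ T, ∀ ω, ∫⁻ σ in Set.Ioc t τ, ‖X σ ω - X' σ ω‖ₑ ∂lebesgueHalfLine
      = ∫⁻ σ in Set.Ioc t τ, u (σ, ω) ∂lebesgueHalfLine := fun τ hτ ω =>
    setLIntegral_congr_fun measurableSet_Ioc fun σ hσ => (huX σ (hσ.2.trans hτ) ω).symm
  obtain ⟨a, ha⟩ : ∃ a : ℝ≥0, (a : ℝ≥0∞) = M * ‖x - x'‖ₑ := ⟨M * ‖x - x'‖₊, by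
    rw [ENNReal.coe_mul]; rfl⟩
  -- The exceptional null set depends on `τ`. Joint measurability lets Fubini exchange the
  -- quantifiers, which is why Gronwall was stated for almost every time.
  have hprop : ∀ᵐ ω ∂P, ∀ᵐ τ ∂lebesgueHalfLine, τ ∈ Set.Ioc t T →
      u (τ, ω) ≤ a + (M * L : ℝ≥0) * ∫⁻ σ in Set.Ioc t τ, u (σ, ω) ∂lebesgueHalfLine := by
    rw [← Measure.ae_ae_comm]
    · refine ae_of_all _ fun τ => ?_
      by_cases hτ : τ ∈ Set.Ioc t T
      · filter_upwards [hineq hτ.1.le hτ.2] with ω hω _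
        rwa [huX τ hτ.2, ha, ← hint τ hτ.2]
      · exact ae_of_all _ fun ω h => absurd h hτ
    · have hJ : Measurable fun z : ℝ≥0 × Ω =>
          ∫⁻ σ in Set.Ioc t z.1, u (σ, z.2) ∂lebesgueHalfLine := by
        have hset : MeasurableSet {y : (ℝ≥0 × Ω) × ℝ≥0 | y.2 ∈ Set.Ioc t y.1.1} := by
          have h1 : MeasurableSet {y : (ℝ≥0 × Ω) × ℝ≥0 | t < y.2} :=
            measurableSet_lt measurable_const measurable_snd
          have h2 : MeasurableSet {y : (ℝ≥0 × Ω) × ℝ≥0 | y.2 ≤ y.1.1} :=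
            measurableSet_le (f := fun y : (ℝ≥0 × Ω) × ℝ≥0 => y.2) (g := fun y => y.1.1)
              measurable_snd measurable_fst.fst
          exact h1.inter h2
        have h1 : Measurable fun y : (ℝ≥0 × Ω) × ℝ≥0 =>
            {y : (ℝ≥0 × Ω) × ℝ≥0 | y.2 ∈ Set.Ioc t y.1.1}.indicator
              (fun y => u (y.2, y.1.2)) y :=
          (hum.comp (measurable_snd.prodMk measurable_fst.snd)).indicator hset
        have h2 := h1.lintegral_prod_right' (ν := lebesgueHalfLine)
        convert h2 using 2 with z
        rw [← lintegral_indicator measurableSet_Ioc]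
        rfl
      have hle : MeasurableSet {z : ℝ≥0 × Ω | u z ≤ a + (M * L : ℝ≥0)
          * ∫⁻ σ in Set.Ioc t z.1, u (σ, z.2) ∂lebesgueHalfLine} :=
        measurableSet_le hum ((hJ.const_mul _).const_add _)
      exact (measurable_fst measurableSet_Ioc).imp hle
  have hfin : ∀ᵐ ω ∂P, ∫⁻ σ in Set.Ioc t T, u (σ, ω) ∂lebesgueHalfLine < ∞ := by
    refine ae_lt_top hum.lintegral_prod_left' ?_
    rw [lintegral_lintegral_swap (f := fun ω σ => u (σ, ω))
      (hum.comp measurable_swap).aemeasurable]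
    set c := ∫⁻ ω, ⨆ τ ∈ Set.Iic T, ‖X τ ω‖ₑ ^ p ∂P
    set c' := ∫⁻ ω, ⨆ τ ∈ Set.Iic T, ‖X' τ ω‖ₑ ^ p ∂P
    have hc : c < ∞ := hX.memSp.2
    have hc' : c' < ∞ := hX'.memSp.2
    have hle : ∀ σ ∈ Set.Ioc t T, ∫⁻ ω, u (σ, ω) ∂P ≤ (1 + c) + (1 + c') := fun σ hσ => by
      calc _ ≤ ∫⁻ ω, (‖X σ ω‖ₑ + ‖X' σ ω‖ₑ) ∂P := lintegral_mono fun ω => by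
            rw [huX σ hσ.2]; exact enorm_sub_le
        _ = ∫⁻ ω, ‖X σ ω‖ₑ ∂P + ∫⁻ ω, ‖X' σ ω‖ₑ ∂P :=
            lintegral_add_left (hX.memSp.stronglyMeasurable_apply hσ.2).enorm _
        _ ≤ _ := add_le_add (MemSp.lintegral_enorm_le hp hσ.2) (MemSp.lintegral_enorm_le hp hσ.2)
    refine ((setLIntegral_mono' measurableSet_Ioc hle).trans_lt ?_).ne
    rw [setLIntegral_const, lebesgueHalfLine_Ioc]
    refine ENNReal.mul_lt_top ?_ ENNReal.ofReal_lt_top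
    simp [hc, hc']
  filter_upwards [hineq ht hτ, hprop, hfin] with ω h1 h2 h3
  have h4 := hK t (fun σ => u (σ, ω)) a (ht.trans hτ) h3.ne h2
  rw [hint τ hτ, ← ha] at h1
  calc _ ≤ (a : ℝ≥0∞) + (M * L : ℝ≥0) * (K * a) := by
        refine h1.trans ?_
        gcongr
        exact (lintegral_mono_set (Set.Ioc_subset_Ioc_right hτ)).trans h4
    _ = _ := by
        rw [ha]; push_cast; ring

end

/-! ### Moment bounds for the Bismut weight -/

lemma enorm_innerSL {Ξ : Type*} [NormedAddCommGroup Ξ] [InnerProductSpace ℝ Ξ] (y : Ξ) :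
    ‖innerSL ℝ y‖ₑ = ‖y‖ₑ := by
  rw [← ofReal_norm, innerSL_apply_norm, ofReal_norm]

/-- The supremum over an interval of a continuous function is attained along a dense sequence. -/
lemma exists_seq_forall_iSup_enorm_le {a b : ℝ≥0} (hab : a ≤ b) : ∃ d : ℕ → ℝ≥0,
    (∀ n, d n ∈ Set.Icc a b) ∧ ∀ f : ℝ≥0 → ℝ, ContinuousOn f (Set.Icc a b) →
      ∀ s ∈ Set.Icc a b, ‖f s‖ₑ ≤ ⨆ n, ‖f (d n)‖ₑ := by
  have : Nonempty (Set.Icc a b) := ⟨⟨a, le_rfl, hab⟩⟩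
  refine ⟨fun n => TopologicalSpace.denseSeq (Set.Icc a b) n, fun n => Subtype.coe_prop _,
    fun f hf s hs => ?_⟩
  have hf' := hf.domRestrict
  refine (TopologicalSpace.denseRange_denseSeq (Set.Icc a b)).induction_on
    (p := fun s => ‖f s‖ₑ ≤ ⨆ n, ‖f (TopologicalSpace.denseSeq (Set.Icc a b) n)‖ₑ) ⟨s, hs⟩ ?_ ?_
  · exact isClosed_le (hf'.enorm) continuous_const
  · exact fun n => le_iSup (fun n => ‖f (TopologicalSpace.denseSeq (Set.Icc a b) n)‖ₑ) n

section

variable {Ω H Ξ : Type*} {mΩ : MeasurableSpace Ω} {P : Measure Ω} [IsProbabilityMeasure P]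
  [P.IsComplete]
  [NormedAddCommGroup H] [InnerProductSpace ℝ H]
  [NormedAddCommGroup Ξ] [InnerProductSpace ℝ Ξ]
  {W : ℝ≥0 → Ξ → Ω → ℝ} {hW : IsCylindricalWiener W P} {T t : ℝ≥0}
  {G : ℝ≥0 → Ξ →L[ℝ] H} {V : ℝ≥0 → Ω → H} {U : ℝ≥0 → Ω → ℝ}

/-- If `V` is uniformly bounded, so is the energy of the integrand of the Bismut weight. -/
lemma ae_lintegral_inverse_apply_le {p : ℝ} (hV : MemSp (wienerFiltration hW) P T p V) {B R : ℝ≥0}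
    (hG : ∀ r ≤ T, ‖(G r).inverse‖ₑ ≤ B)
    (hVR : ∀ τ, t ≤ τ → τ ≤ T → ∀ᵐ ω ∂P, ‖V τ ω‖ₑ ≤ R) {v : ℝ≥0} (htv : t ≤ v) (hv : v ≤ T) :
    ∀ᵐ ω ∂P, ∫⁻ σ in Set.Ioc t v, ‖innerSL ℝ ((G σ).inverse (V σ ω))‖ₑ ^ 2 ∂lebesgueHalfLine
      ≤ ENNReal.ofReal ((B * R * √(v - t)) ^ 2) := by
  have hVm := hV.1.stronglyMeasurable_uncurry.enorm
  have hset : MeasurableSet {z : ℝ≥0 × Ω | z.1 ∈ Set.Ioc t v →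
      ‖Function.uncurry (fun τ ω => (Set.Iic T).indicator (fun r => V r ω) τ) z‖ₑ ≤ R} :=
    (measurable_fst measurableSet_Ioc).imp (measurableSet_le hVm measurable_const)
  have hae : ∀ᵐ ω ∂P, ∀ᵐ τ ∂lebesgueHalfLine, τ ∈ Set.Ioc t v →
      ‖(Set.Iic T).indicator (fun r => V r ω) τ‖ₑ ≤ R := by
    rw [← Measure.ae_ae_comm hset]
    refine ae_of_all _ fun τ => ?_
    by_cases hτ : τ ∈ Set.Ioc t v
    · have hτT := hτ.2.trans hv
      filter_upwards [hVR τ hτ.1.le hτT] with ω hω _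
      rwa [Set.indicator_of_mem (Set.mem_Iic.2 hτT)]
    · exact ae_of_all _ fun ω h => absurd h hτ
  filter_upwards [hae] with ω hω
  have hnn : (0 : ℝ) ≤ (v : ℝ) - t := sub_nonneg.2 (by exact_mod_cast htv)
  calc _ ≤ ∫⁻ σ in Set.Ioc t v, ((B * R : ℝ≥0) : ℝ≥0∞) ^ 2 ∂lebesgueHalfLine := by
        refine setLIntegral_mono_ae' measurableSet_Ioc ?_
        filter_upwards [hω] with τ hτ hmem
        have hτT := hmem.2.trans hv
        have h1 := hτ hmem
        rw [Set.indicator_of_mem (Set.mem_Iic.2 hτT)] at h1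
        rw [enorm_innerSL, ENNReal.coe_mul]
        gcongr
        exact ((G τ).inverse.le_opENorm _).trans (by gcongr; exact hG τ hτT)
    _ = _ := by
        rw [setLIntegral_const, lebesgueHalfLine_Ioc, mul_pow, Real.sq_sqrt hnn,
          ENNReal.ofReal_mul (by positivity), ENNReal.ofReal_pow (by positivity)]
        congr 2
        rw [← NNReal.coe_mul, ENNReal.ofReal_coe_nnreal]

variable [TopologicalSpace.SeparableSpace Ξ]

/-- Moment bound for the supremum of a Bismut weight over countably many times. -/
lemma IsBismutWeight.lintegral_iSup_rpow_le {q C : ℝ} (hq : 1 ≤ q)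
    (hC : ∀ {Y : Ω → ℝ≥0∞} (_ : AEMeasurable Y P) {ρ : ℝ} (_ : 0 < ρ)
      (_ : ∀ a : ℝ, 0 < a → P {ω | ENNReal.ofReal (2 * a) < Y ω}
        ≤ 2 * ENNReal.ofReal (Real.exp (-(a ^ 2 / (8 * ρ ^ 2))))),
      (∫⁻ ω, Y ω ^ q ∂P) ^ (1 / q) ≤ ENNReal.ofReal (C * ρ))
    (hU : IsBismutWeight W (wienerFiltration hW) P G T t V U)
    {p : ℝ} (hV : MemSp (wienerFiltration hW) P T p V) {B R : ℝ≥0}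
    (hG : ∀ r ≤ T, ‖(G r).inverse‖ₑ ≤ B)
    (hVR : ∀ τ, t ≤ τ → τ ≤ T → ∀ᵐ ω ∂P, ‖V τ ω‖ₑ ≤ R) {v : ℝ≥0} (htv : t < v) (hv : v ≤ T)
    {m : ℝ} (hm : 0 < m) (d : ℕ → ℝ≥0) (hdt : ∀ n, m ≤ d n - t) (hdv : ∀ n, d n ≤ v) :
    (∫⁻ ω, (⨆ n, ‖U (d n) ω‖ₑ) ^ q ∂P) ^ (1 / q)
      ≤ ENNReal.ofReal (m⁻¹ * (C * (B * R * √(v - t)))) := by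
  have hq0 : 0 < q := by linarith
  have hL : 0 < √((v : ℝ) - t) := Real.sqrt_pos.2 (sub_pos.2 (by exact_mod_cast htv))
  have hdt' : ∀ n, t < d n := fun n => by
    have := hdt n
    have h : (t : ℝ) < d n := by linarith
    exact_mod_cast h
  choose! M hM hUM using hU.eq_integral
  have hYm : AEMeasurable (fun ω => ⨆ n, ‖M (d n) ω‖ₑ) P :=
    AEMeasurable.iSup fun n => (hM _ (hdt' n) ((hdv n).trans hv)).2.1.enorm
  -- The tail estimate needs a positive scale, while `B * R` may vanish (for instance when `h = 0`);
  -- `η` is sent to zero afterwards.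
  have hbound : ∀ η : ℝ≥0, 0 < η → (∫⁻ ω, (⨆ n, ‖M (d n) ω‖ₑ) ^ q ∂P) ^ (1 / q)
      ≤ ENNReal.ofReal (C * ((B * R + η) * √(v - t))) := fun η hη => by
    have hρ : 0 < (B * R + η) * √((v : ℝ) - t) := by positivity
    refine hC hYm hρ fun a ha => ?_
    refine IsItoIntegral.measure_lt_iSup_enorm (hM v htv hv) (by positivity) ?_ d hdv
      (fun n => hM _ (hdt' n) ((hdv n).trans hv)) ha
    filter_upwards [ae_lintegral_inverse_apply_le hV hG hVR htv.le hv] with ω hω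
    refine hω.trans (ENNReal.ofReal_le_ofReal ?_)
    gcongr
    exact le_add_of_nonneg_right η.2
  have hlim : Tendsto (fun η : ℝ≥0 => ENNReal.ofReal (C * ((B * R + η) * √(v - t)))) (𝓝[>] 0)
      (𝓝 (ENNReal.ofReal (C * (B * R * √(v - t))))) := by
    have : Continuous fun η : ℝ≥0 => ENNReal.ofReal (C * ((B * R + η) * √(v - t))) :=
      ENNReal.continuous_ofReal.comp (by fun_prop)
    have h0 := this.tendsto 0
    simp only [NNReal.coe_zero, add_zero] at h0
    exact h0.mono_left nhdsWithin_le_nhds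
  have hMq : (∫⁻ ω, (⨆ n, ‖M (d n) ω‖ₑ) ^ q ∂P) ^ (1 / q)
      ≤ ENNReal.ofReal (C * (B * R * √(v - t))) :=
    ge_of_tendsto hlim (by filter_upwards [self_mem_nhdsWithin] with η hη using hbound η hη)
  have hUle : ∀ᵐ ω ∂P, ⨆ n, ‖U (d n) ω‖ₑ ≤ ENNReal.ofReal m⁻¹ * ⨆ n, ‖M (d n) ω‖ₑ := by
    filter_upwards [ae_all_iff.2 fun n => hUM _ (hdt' n) ((hdv n).trans hv)] with ω hω
    refine iSup_le fun n => ?_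
    rw [hω n, enorm_mul]
    refine mul_le_mul' ?_ (le_iSup (fun n => ‖M (d n) ω‖ₑ) n)
    rw [← ofReal_norm, norm_inv, Real.norm_of_nonneg (hm.le.trans (hdt n))]
    exact ENNReal.ofReal_le_ofReal (inv_anti₀ hm (hdt n))
  calc _ ≤ (∫⁻ ω, ENNReal.ofReal m⁻¹ ^ q * (⨆ n, ‖M (d n) ω‖ₑ) ^ q ∂P) ^ (1 / q) := by
        refine ENNReal.rpow_le_rpow (lintegral_mono_ae ?_) (by positivity)
        filter_upwards [hUle] with ω hω
        rw [← ENNReal.mul_rpow_of_nonneg _ _ hq0.le]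
        exact ENNReal.rpow_le_rpow hω hq0.le
    _ = ENNReal.ofReal m⁻¹ * (∫⁻ ω, (⨆ n, ‖M (d n) ω‖ₑ) ^ q ∂P) ^ (1 / q) := by
        rw [lintegral_const_mul' _ _ (ENNReal.rpow_ne_top_of_nonneg hq0.le ENNReal.ofReal_ne_top),
          ENNReal.mul_rpow_of_nonneg _ _ (by positivity), ← ENNReal.rpow_mul,
          mul_one_div_cancel hq0.ne', ENNReal.rpow_one]
    _ ≤ ENNReal.ofReal m⁻¹ * ENNReal.ofReal (C * (B * R * √(v - t))) := by gcongr
    _ = _ := (ENNReal.ofReal_mul (by positivity)).symm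

end

/-! ### The main estimate -/

theorem mainTheorem9
    {Ω : Type*} {mΩ : MeasurableSpace Ω} {P : Measure Ω} [IsProbabilityMeasure P] [P.IsComplete]
    {H : Type*} [NormedAddCommGroup H] [InnerProductSpace ℝ H] [CompleteSpace H]
    [TopologicalSpace.SeparableSpace H] [MeasurableSpace H] [BorelSpace H]
    {Ξ : Type*} [NormedAddCommGroup Ξ] [InnerProductSpace ℝ Ξ] [CompleteSpace Ξ]
    [TopologicalSpace.SeparableSpace Ξ]
    {W : ℝ≥0 → Ξ → Ω → ℝ} (hW : IsCylindricalWiener W P)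
    {T : ℝ≥0} {A : H →ₗ.[ℝ] H} {S : ℝ≥0 → H →L[ℝ] H} {F : ℝ≥0 → H → H} {G : ℝ≥0 → Ξ →L[ℝ] H}
    (hforward : ForwardHypothesis T A S F G) (hregular : ForwardRegularity T F G)
    (hinv : UniformlyInvertible T G) (q : ℝ) (hq : 1 ≤ q) :
    ∃ C : ℝ, 0 < C ∧ ∀ (p : ℝ) (_ : 1 ≤ p) (t : ℝ≥0) (_ : t < T) (X : H → ℝ≥0 → Ω → H)
      (_ : ∀ x, IsMildSolution W (wienerFiltration hW) P S F G T p t x (X x))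
      (x h : H) (V : ℝ≥0 → Ω → H)
      (_ : IsDirectionalDerivSp (wienerFiltration hW) P T p X x h V)
      (U : ℝ≥0 → Ω → ℝ) (_ : IsBismutWeight W (wienerFiltration hW) P G T t V U),
      (∀ s : ℝ≥0, t < s → s ≤ T →
        (∫⁻ ω, ‖U s ω‖ₑ ^ q ∂P) ^ (1 / q)
          ≤ ENNReal.ofReal (C * ((s : ℝ) - t) ^ (-(1 / 2) : ℝ) * ‖h‖)) ∧
      (∫⁻ ω, ⨆ s ∈ Set.Icc ((t + T) / 2) T, ‖U s ω‖ₑ ^ q ∂P) ^ (1 / q)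
        ≤ ENNReal.ofReal (C * ((T : ℝ) - t) ^ (-(1 / 2) : ℝ) * ‖h‖) := by
  have hq0 : 0 < q := by linarith
  obtain ⟨M, hM⟩ := hforward.semigroup.exists_norm_le T
  obtain ⟨L, hL0, hL⟩ := hforward.bound_F
  obtain ⟨B, hB⟩ := hinv
  obtain ⟨C, hC0, hC⟩ := exists_forall_lintegral_rpow_le_of_gaussian_tail hq
  have hL' : ∀ s ≤ T, ∀ y z : H, ‖F s y - F s z‖ₑ ≤ L.toNNReal * ‖y - z‖ₑ := fun s hs y z => by
    rw [← ofReal_norm, ← ofReal_norm]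
    change _ ≤ ENNReal.ofReal L * _
    rw [← ENNReal.ofReal_mul hL0.le]
    exact ENNReal.ofReal_le_ofReal (hL s hs y z).2
  have hG : ∀ r ≤ T, ‖(G r).inverse‖ₑ ≤ B.toNNReal := fun r hr => by
    rw [← ofReal_norm]
    exact ENNReal.ofReal_le_ofReal (hB r hr).2
  obtain ⟨K, hK⟩ := exists_forall_isMildSolution_enorm_sub_le (hW := hW) (G := G) hM hL'
  set B' := B.toNNReal
  -- `C` comes from the moment bound, `B' * K` bounds the integrand per unit of `|h|`, the `2` pays
  -- for times down to the midpoint, and the `+ 1` ensures positivity.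
  refine ⟨2 * C * (B' * K + 1), by positivity, fun p hp t htT X hX x h V hV U hU => ?_⟩
  have hVR : ∀ τ, t ≤ τ → τ ≤ T → ∀ᵐ ω ∂P, ‖V τ ω‖ₑ ≤ (K * ‖h‖₊ : ℝ≥0) := fun τ ht hτ => by
    have := hV.ae_enorm_le hp hτ fun y => hK p hp t y x _ _ (hX y) (hX x) τ ht hτ
    filter_upwards [this] with ω hω
    rwa [ENNReal.coe_mul]
  have hmoment := fun {v : ℝ≥0} => hU.lintegral_iSup_rpow_le (v := v) hq hC hV.1 hG hVR
  -- The factor `m⁻¹` is at most `2 (v - t)⁻¹`, and `√(v - t)` cancels half of this power. It is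
  -- used with `m = s - t` and with `m = (T - t) / 2`.
  have hconst : ∀ {v : ℝ≥0} (_ : t < v) {m : ℝ} (_ : 0 < m) (_ : ((v : ℝ) - t) / 2 ≤ m),
      m⁻¹ * (C * (B' * (K * ‖h‖₊ : ℝ≥0) * √(v - t)))
        ≤ 2 * C * (B' * K + 1) * ((v : ℝ) - t) ^ (-(1 / 2) : ℝ) * ‖h‖ := by
    intro v htv m hm hvm
    have hpos : 0 < (v : ℝ) - t := sub_pos.2 (by exact_mod_cast htv)
    have hsqrt := Real.sqrt_pos.2 hpos
    rw [Real.rpow_neg hpos.le, ← Real.sqrt_eq_rpow]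
    have hm' : m⁻¹ ≤ 2 * ((√((v : ℝ) - t))⁻¹ * (√((v : ℝ) - t))⁻¹) := by
      rw [← mul_inv, Real.mul_self_sqrt hpos.le]
      calc m⁻¹ ≤ (((v : ℝ) - t) / 2)⁻¹ := inv_anti₀ (by positivity) hvm
        _ = _ := by rw [inv_div, div_eq_mul_inv]
    push_cast
    calc _ ≤ 2 * ((√((v : ℝ) - t))⁻¹ * (√((v : ℝ) - t))⁻¹)
          * (C * (B' * (K * ‖h‖) * √(v - t))) := by gcongr
      _ = 2 * C * (B' * K) * (√((v : ℝ) - t))⁻¹ * ‖h‖ := by field_simp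
      _ ≤ _ := by gcongr; linarith
  refine ⟨fun s hts hsT => ?_, ?_⟩
  · have hpos : 0 < (s : ℝ) - t := sub_pos.2 (by exact_mod_cast hts)
    -- A single time is the case of a constant sequence.
    have := hmoment hts hsT hpos (fun _ => s) (fun _ => le_rfl) (fun _ => le_rfl)
    simp only [ciSup_const] at this
    exact this.trans (ENNReal.ofReal_le_ofReal (hconst hts hpos (by linarith)))
  · have hpos : 0 < (T : ℝ) - t := sub_pos.2 (by exact_mod_cast htT)
    have hmid : (((t + T) / 2 : ℝ≥0) : ℝ) = ((t : ℝ) + T) / 2 := by push_cast; rfl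
    have hmT : (t + T) / 2 ≤ T := by
      rw [← NNReal.coe_le_coe, hmid]; linarith
    obtain ⟨d, hd, hdense⟩ := exists_seq_forall_iSup_enorm_le hmT
    have hdt : ∀ n, ((T : ℝ) - t) / 2 ≤ d n - t := fun n => by
      have := NNReal.coe_le_coe.2 (hd n).1
      rw [hmid] at this
      linarith
    have := hmoment htT le_rfl (half_pos hpos) d hdt (fun n => (hd n).2)
    refine le_trans ?_ (this.trans
      (ENNReal.ofReal_le_ofReal (hconst htT (half_pos hpos) le_rfl)))
    refine ENNReal.rpow_le_rpow (lintegral_mono_ae ?_) (by positivity)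
    filter_upwards [hU.continuous] with ω hω
    have hsub : Set.Icc ((t + T) / 2) T ⊆ Set.Ioc t T := fun s hs => by
      refine ⟨?_, hs.2⟩
      have := NNReal.coe_le_coe.2 hs.1
      rw [hmid] at this
      rw [← NNReal.coe_lt_coe]
      linarith
    exact iSup₂_le fun s hs =>
      ENNReal.rpow_le_rpow (hdense _ (hω.mono hsub) s hs) hq0.le
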